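/- Consider the Congested Clique with crash faults: $n$ nodes $1,\dots,n$, which know $n$ and each other's identifiers ($KT_1$), run a deterministic algorithm in synchronous rounds; in each round every running node sends at most one message to each other node, receives the messages sent to it, and then continues or terminates with an output. At the beginning node $v$ knows only its identifier and its own input degree $d_v$. An adaptive adversary, which sees the whole execution so far, may in each round crash any of the running nodes; of the messages that a node sends in the round of its crash only a subset chosen by the adversary is delivered, and afterwards the node is inactive. For every fixed $k\in\mathbb N$ there are a constant $C$ and, for every $n$, a deterministic algorithm using messages of at most $C\lfloor\log_2 n\rfloor$ bits (the algorithm does not depend on $f$) such that the following holds for all $f<n$, all input sequences $D=(d_1,\dots,d_n)$ of natural numbers with $d_v\le n^k$ (in particular for all graphic $D$), and all adaptive adversaries that crash at most $f$ nodes in the execution. 1. After at most $C(f+1)$ rounds every node that has not crashed has terminated. 2. There is a subsequence $D'=(d_v)_{v\in S}$ of $D$ with $|S|\ge n-f$ such that all nodes outside $S$ have crashed and every node that has not crashed outputs this same $D'$ together with the outcome $G'$ of the (sequential, locally executed) Havel–Hakimi algorithm on $D'$. If $D'$ is realizable, then $G'$ is a graph on $S$ in which every $v\in S$ has degree $d_v$;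 otherwise the outcome is "unrealizable". 3. In total, over all rounds, at most $Cn^2$ messages are sent (lost messages included). -/

import Mathlib

/-! ### The Congested Clique with crash faults -/

/-- What a node hands out when it terminates: a degree sequence indexed by the set `nodes` of those
nodes of the clique whose degrees were retained, together with an overlay graph on these nodes, or
`none`, which stands for the answer "unrealizable". -/
structure Output (n : ℕ) where
  nodes : Finset (Fin n)
  degrees : nodes → ℕ
  overlay : Option (SimpleGraph nodes)

/-- A message of at most `B` bits. -/
abbrev Message (B : ℕ) : Type := {m : List Bool // m.length ≤ B}

/-- A deterministic synchronous algorithm on an `n`-node clique in which messages have at most `B`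
bits. The nodes know `n` and all identifiers, and they address each other by identifier. At the
start a node only knows its own identifier and its own input degree. In each round a node sends to
each other node at most one message (`send`), receives at most one message from each other node,
and then either goes on with a new local state or terminates with an output (`receive`). -/
structure Protocol (n B : ℕ) where
  State : Type
  init : Fin n → ℕ → State
  send : State → Fin n → Option (Message B)
  receive : State → (Fin n → Option (Message B)) → State ⊕ Output n

/-- The situation of a node between two rounds. -/
inductive Status {n B : ℕ} (P : Protocol n B) where
  | running (s : P.State)
  | halted (o : Output n)
  | crashed

/-- A global configuration between two rounds. -/
abbrev Config {n B : ℕ} (P : Protocol n B) : Type := Fin n → Status P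

/-- The crashes of one round: `none` at a node that does not crash, and `some R` at a node that
crashes in this round, where only its messages to the nodes of `R` are still delivered. -/
abbrev Crashes (n : ℕ) : Type := Fin n → Option (Finset (Fin n))

/-- An adaptive adversary: it sees the current configuration and all earlier ones (latest first),
hence also all messages about to be sent, and decides on the crashes of the current round. -/
abbrev Adversary {n B : ℕ} (P : Protocol n B) : Type :=
  List (Config P) → Config P → Crashes n

namespace Config

variable {n B : ℕ} {P : Protocol n B}

/-- The message that `u` sends to `w` in the round that starts from `c`. Only running nodes send,
and only to the other nodes. -/
def sent (c : Config P) (u w : Fin n) : Option (Message B) :=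
  match c u with
  | .running s => if u = w then none else P.send s w
  | _ => none

/-- The message from `u` that reaches `w`, under the crashes `x` of the round. -/
def delivered (c : Config P) (x : Crashes n) (u w : Fin n) : Option (Message B) :=
  match x u with
  | none => c.sent u w
  | some R => if w ∈ R then c.sent u w else none

/-- One round. Nodes that have terminated or crashed before stay as they are. -/
def step (c : Config P) (x : Crashes n) : Config P := fun v =>
  match c v with
  | .running s =>
    match x v with
    | some _ => .crashed
    | none =>
      match P.receive s (fun u => c.delivered x u v) with
      | .inl s' => .running s'
      | .inr o => .halted o
  | .halted o => .halted o
  | .crashed => .crashed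

/-- The number of messages sent in the round that starts from `c`, whether or not they arrive. -/
def numMessages (c : Config P) : ℕ :=
  (Finset.univ.filter fun p : Fin n × Fin n => (c.sent p.1 p.2).isSome).card

open Classical in
/-- The nodes that have crashed (before terminating). -/
noncomputable def crashedNodes (c : Config P) : Finset (Fin n) :=
  Finset.univ.filter fun v => c v = .crashed

end Config

namespace Protocol

variable {n B : ℕ}

/-- The configuration after `r` rounds on input `D` against the adversary `adv`, together with the
list of all earlier configurations. -/
def exec (P : Protocol n B) (D : Fin n → ℕ) (adv : Adversary P) : ℕ → List (Config P) × Config P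
  | 0 => ([], fun v => .running (P.init v (D v)))
  | r + 1 =>
    let e := P.exec D adv r
    (e.2 :: e.1, e.2.step (adv e.1 e.2))

/-- The configuration after `r` rounds. -/
def config (P : Protocol n B) (D : Fin n → ℕ) (adv : Adversary P) (r : ℕ) : Config P :=
  (P.exec D adv r).2

end Protocol

/-! ### Degree sequences and the Havel–Hakimi algorithm -/

open Classical in
/-- In the graph `G`, every vertex `v` has degree `d v`. -/
def Realizes {V : Type} [Fintype V] (G : SimpleGraph V) (d : V → ℕ) : Prop :=
  ∀ v, G.degree v = d v

/-- The Havel–Hakimi recursion, for at most the given number of steps, on a list of vertices with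
residual degrees: sort by non-increasing residual degree, join the first vertex, of residual degree
`d`, to the `d` vertices that follow it, decrease the residual degrees of these by one, and go on
with the remaining list. The outcome is the list of edges, or `none` if there are fewer than `d`
vertices left or a residual degree would become negative. -/
def havelHakimiEdges {V : Type} : ℕ → List (V × ℕ) → Option (List (V × V))
  | 0, _ => some []
  | k + 1, L =>
    match L.mergeSort (fun a b => decide (b.2 ≤ a.2)) with
    | [] => some []
    | (v, d) :: rest =>
      if rest.length < d ∨ ∃ a ∈ rest.take d, a.2 = 0 then none
      else
        (havelHakimiEdges k ((rest.take d).map (fun a => (a.1, a.2 - 1)) ++ rest.drop d)).map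
          (fun E => (rest.take d).map (fun a => (v, a.1)) ++ E)

/-- The Havel–Hakimi algorithm: the graph it builds for the degree sequence `d` (with vertices
listed in increasing order at the start), or `none` if it rejects `d`. -/
def havelHakimi {V : Type} [Fintype V] [LinearOrder V] (d : V → ℕ) : Option (SimpleGraph V) :=
  (havelHakimiEdges (Fintype.card V)
    (((Finset.univ : Finset V).sort (· ≤ ·)).map (fun v => (v, d v)))).map
      (fun E => SimpleGraph.fromRel (fun a b => (a, b) ∈ E))

/-! ### Degree-sequence realization with faults -/

/-- The final configuration `c` solves degree-sequence realization with faults on input `D` with at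
most `f` faults: there is one subsequence `D'` of `D` with at least `n - f` entries which lacks only
degrees of crashed nodes, every node that has not crashed has terminated with `D'` and with the
outcome `G'` of the Havel–Hakimi algorithm on `D'`, and `G'` is a graph that realizes `D'` if there
is one, and is "unrealizable" otherwise. -/
def SolvesRealization {n B : ℕ} {P : Protocol n B} (D : Fin n → ℕ) (f : ℕ) (c : Config P) : Prop :=
  ∃ (S : Finset (Fin n)) (D' : S → ℕ) (G' : Option (SimpleGraph S)),
    (∀ v : S, D' v = D v) ∧
    n ≤ S.card + f ∧
    (∀ v, v ∉ S → v ∈ c.crashedNodes) ∧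
    (∀ v, v ∉ c.crashedNodes → c v = .halted ⟨S, D', G'⟩) ∧
    G' = havelHakimi D' ∧
    (∀ G, G' = some G → Realizes G D') ∧
    (G' = none → ¬ ∃ G : SimpleGraph S, Realizes G D')

/-! ### Correctness of the Havel–Hakimi algorithm. -/

section HavelHakimi

open Finset

/-! Two independent facts combine: Havel–Hakimi is correct, and the nodes can agree on the set of
degrees to leave out.

Havel–Hakimi rests on an exchange. If `v` is adjacent to `b` but not to `a`, and `a` has at least
the degree of `b`, then some `c` is adjacent to `a` but not to `b`, and trading the edges `vb`, `ac`
for `va`, `bc` keeps all degrees. Hence a realizable sequence has a realization that joins `v` to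
the largest other degrees, and isolating `v` realizes the reduced sequence
(`ListsDegrees.exists_reduced`). Conversely, `v` can be joined again (`degree_fromRel_map_append`).

For agreement, all nodes broadcast their degrees, and each proposes to exclude those it has not
heard from, which have crashed. Then come phases of four rounds. Each node has a pointer to a
supposed leader, which moves only past crashed nodes. The leader collects from each node one
proposed but unconfirmed node, announces one of these, and repeats it in the next round. A leader
that lives to repeat an item has delivered it to everyone, so confirmed nodes are proposed by all
running nodes. If no objection is left, every proposal equals its owner's confirmed set, which lies
in all other proposals, so all proposals coincide. The leader announces this; informed nodes pass it
on once and halt, and a single one that survives doing so informs all others.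

Progress is the number of crashes, plus a common lower bound `g` of the pointers, plus the size of a
set `F` confirmed by all. Each phase raises it, unless all running nodes become informed: a node
crashes, or all pointers pass `g`, or the leader enlarges `F`. All three terms are at most `f`
(`Good.progress_le`), so `3f + 1` phases suffice. After the first broadcast a round costs at most
`4n` messages, apart from the broadcasts of informed nodes, which are paid for once per node because
such a node stops running. As `f < n`, the total is quadratic in `n`. -/

open Classical in
theorem exists_exchange {V : Type} [Fintype V] (G : SimpleGraph V) {v a b : V}
    (hvb : G.Adj v b) (hva : ¬ G.Adj v a) (hav : a ≠ v) (hd : G.degree b ≤ G.degree a) :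
    ∃ c, c ≠ v ∧ c ≠ a ∧ c ≠ b ∧ G.Adj a c ∧ ¬ G.Adj b c := by
  by_contra! h
  have hab : a ≠ b := by rintro rfl; exact hva hvb
  -- Without such a `c`, outside the pair `a`, `b` the neighbours of `a` form a proper subset of
  -- those of `b`, `v` being extra. An edge `ab` would count equally in both degrees.
  have hsub : G.neighborFinset a \ {b} ⊂ G.neighborFinset b \ {a} := by
    rw [Finset.ssubset_iff_of_subset]
    · exact ⟨v, by simp [hvb.symm, hav.symm], by simp [G.adj_comm a v, hva]⟩
    · intro c hc
      simp only [mem_sdiff, SimpleGraph.mem_neighborFinset, mem_singleton] at hc ⊢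
      have hca : c ≠ a := hc.1.ne'
      have hcv : c ≠ v := by rintro rfl; exact hva hc.1.symm
      exact ⟨h c hcv hca hc.2 hc.1, hca⟩
  have h1 := Finset.card_lt_card hsub
  have key : ∀ x y : V, (G.neighborFinset x \ {y}).card + (if G.Adj x y then 1 else 0)
      = G.degree x := by
    intro x y
    split_ifs with hxy
    · rw [← SimpleGraph.card_neighborFinset_eq_degree, sdiff_singleton_eq_erase,
        card_erase_add_one (by simpa using hxy)]
    · rw [← SimpleGraph.card_neighborFinset_eq_degree, sdiff_singleton_eq_erase,
        erase_eq_of_notMem (by simpa using hxy), add_zero]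
  have h2 := key a b
  have h3 := key b a
  rw [G.adj_comm b a] at h3
  omega

/-- The graph obtained from `G` by replacing the edges `vb`, `ac` by `va`, `bc`. -/
def SimpleGraph.exchange {V : Type} (G : SimpleGraph V) (v a b c : V) : SimpleGraph V :=
  SimpleGraph.fromRel fun x y =>
    (G.Adj x y ∧ s(x, y) ≠ s(v, b) ∧ s(x, y) ≠ s(a, c)) ∨ s(x, y) = s(v, a) ∨ s(x, y) = s(b, c)

theorem SimpleGraph.exchange_adj {V : Type} (G : SimpleGraph V) {v a b c : V} (hav : a ≠ v)
    (hbc : c ≠ b) (x y : V) :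
    (G.exchange v a b c).Adj x y ↔
      (G.Adj x y ∧ s(x, y) ≠ s(v, b) ∧ s(x, y) ≠ s(a, c)) ∨ s(x, y) = s(v, a) ∨
        s(x, y) = s(b, c) := by
  rw [SimpleGraph.exchange, SimpleGraph.fromRel_adj, G.adj_comm y x, Sym2.eq_swap (a := y), or_self]
  constructor
  · exact fun h => h.2
  · refine fun h => ⟨?_, h⟩
    rintro rfl
    simp only [SimpleGraph.irrefl, false_and, Sym2.eq_iff, false_or] at h
    grind

-- Each of the four vertices trades one neighbour for another: `v` trades `b` for `a`, `a` trades
-- `c` for `v`, `b` trades `v` for `c`, and `c` trades `a` for `b`.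
open Classical in
theorem SimpleGraph.degree_exchange {V : Type} [Fintype V] (G : SimpleGraph V) {v a b c : V}
    (hvb : G.Adj v b) (hva : ¬ G.Adj v a) (hav : a ≠ v) (hcv : c ≠ v) (hca : c ≠ a) (hcb : c ≠ b)
    (hac : G.Adj a c) (hbc : ¬ G.Adj b c) (x : V) :
    (G.exchange v a b c).degree x = G.degree x := by
  have hab : a ≠ b := by rintro rfl; exact hva hvb
  have hbv : b ≠ v := hvb.ne'
  have replace_card : ∀ (S : Finset V) (p q : V), p ∈ S → q ∉ S →
      (insert q (S.erase p)).card = S.card := by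
    intro S p q hp hq
    rw [card_insert_of_notMem (by simp [hq]), card_erase_add_one hp]
  rw [← SimpleGraph.card_neighborFinset_eq_degree, ← SimpleGraph.card_neighborFinset_eq_degree]
  have hN : ∀ y, y ∈ (G.exchange v a b c).neighborFinset x ↔
      (G.Adj x y ∧ s(x, y) ≠ s(v, b) ∧ s(x, y) ≠ s(a, c)) ∨ s(x, y) = s(v, a) ∨
        s(x, y) = s(b, c) := by
    intro y
    rw [SimpleGraph.mem_neighborFinset, G.exchange_adj hav hcb]
  have hva' : ¬ G.Adj a v := fun h => hva h.symm
  have hbc' : ¬ G.Adj c b := fun h => hbc h.symm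
  have hvb' := hvb.symm
  have hac' := hac.symm
  by_cases h1 : x = v
  · subst h1
    rw [← replace_card (G.neighborFinset x) b a (by simpa) (by simpa)]
    congr 1; ext y
    rw [hN]; simp only [Sym2.eq_iff, mem_insert, mem_erase, SimpleGraph.mem_neighborFinset]
    grind
  by_cases h2 : x = a
  · subst h2
    rw [← replace_card (G.neighborFinset x) c v (by simpa) (by simpa)]
    congr 1; ext y
    rw [hN]; simp only [Sym2.eq_iff, mem_insert, mem_erase, SimpleGraph.mem_neighborFinset]
    grind
  by_cases h3 : x = b
  · subst h3
    rw [← replace_card (G.neighborFinset x) v c (by simpa) (by simpa)]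
    congr 1; ext y
    rw [hN]; simp only [Sym2.eq_iff, mem_insert, mem_erase, SimpleGraph.mem_neighborFinset]
    grind
  by_cases h4 : x = c
  · subst h4
    rw [← replace_card (G.neighborFinset x) a b (by simpa) (by simpa)]
    congr 1; ext y
    rw [hN]; simp only [Sym2.eq_iff, mem_insert, mem_erase, SimpleGraph.mem_neighborFinset]
    grind
  · congr 1; ext y
    rw [hN]; simp only [Sym2.eq_iff, SimpleGraph.mem_neighborFinset]
    grind

open Classical in
/-- Every graph can be rearranged, with all degrees kept, so that a vertex `v` becomes adjacent to a
given set `T` of as many vertices as it has neighbours, provided that the vertices of `T` have at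
least the degrees of the other vertices. -/
theorem exists_realization_neighborFinset_eq {V : Type} [Fintype V] (v : V) (T : Finset V)
    (hv : v ∉ T) (m : ℕ) (G : SimpleGraph V) (hm : (T \ G.neighborFinset v).card ≤ m)
    (hT : T.card = G.degree v)
    (hmax : ∀ a ∈ T, ∀ b ∉ T, b ≠ v → G.degree b ≤ G.degree a) :
    ∃ G' : SimpleGraph V, (∀ x, G'.degree x = G.degree x) ∧ ∀ x, G'.Adj v x ↔ x ∈ T := by
  induction m generalizing G with
  | zero =>
    have hs : T ⊆ G.neighborFinset v := by
      rw [← sdiff_eq_empty_iff_subset, ← card_eq_zero]; omega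
    have he : T = G.neighborFinset v :=
      eq_of_subset_of_card_le hs (by rw [hT, SimpleGraph.card_neighborFinset_eq_degree])
    exact ⟨G, fun _ => rfl, fun x => by rw [he]; simp⟩
  | succ m ih =>
    by_cases hs : T ⊆ G.neighborFinset v
    · exact ih G (by rw [sdiff_eq_empty_iff_subset.2 hs]; simp) hT hmax
    obtain ⟨a, haT, hva⟩ := not_subset.1 hs
    have hs' : ¬ G.neighborFinset v ⊆ T := fun h => hs
      (eq_of_subset_of_card_le h (by rw [hT, SimpleGraph.card_neighborFinset_eq_degree])).ge
    obtain ⟨b, hvb, hbT⟩ := not_subset.1 hs'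
    rw [SimpleGraph.mem_neighborFinset] at hva hvb
    have hav : a ≠ v := by rintro rfl; exact hv haT
    obtain ⟨c, hcv, hca, hcb, hac, hbc⟩ :=
      exists_exchange G hvb hva hav (hmax a haT b hbT hvb.ne')
    have hdeg := G.degree_exchange hvb hva hav hcv hca hcb hac hbc
    obtain ⟨G', h1, h2⟩ := ih (G.exchange v a b c) (by
      -- The exchange gains `a` for the neighbourhood of `v` and loses only `b`, which is outside
      -- `T`.
      have hsub : T \ (G.exchange v a b c).neighborFinset v ⊆
          (T \ G.neighborFinset v).erase a := by
        intro y
        have hab : a ≠ b := by rintro rfl; exact hva hvb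
        have hbv : b ≠ v := hvb.ne'
        simp only [mem_sdiff, SimpleGraph.mem_neighborFinset, G.exchange_adj hav hcb, mem_erase,
          Sym2.eq_iff]
        grind
      have := card_le_card hsub
      rw [card_erase_of_mem (by simp [haT, hva])] at this
      omega) (by rw [hdeg, hT]) (by simpa only [hdeg] using hmax)
    exact ⟨G', fun x => by rw [h1, hdeg], h2⟩


-- Used in both directions, to remove `v` and to put it back. The vertex stays as an isolated one,
-- so the vertex type never changes during the recursion.
open Classical in
theorem degree_eq_of_adj_iff_delete {V : Type} [Fintype V] {G G' : SimpleGraph V} {v : V}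
    {T : Finset V} (hT : ∀ x, G.Adj v x ↔ x ∈ T)
    (h : ∀ x y, G'.Adj x y ↔ G.Adj x y ∧ x ≠ v ∧ y ≠ v) (x : V) :
    (x = v → G.degree x = T.card ∧ G'.degree x = 0) ∧
      (x ∈ T → G.degree x = G'.degree x + 1) ∧
      (x ≠ v → x ∉ T → G.degree x = G'.degree x) := by
  simp only [← SimpleGraph.card_neighborFinset_eq_degree]
  refine ⟨?_, fun hx => ?_, fun hxv hx => ?_⟩
  · rintro rfl
    constructor
    · congr 1; ext y; simp [hT]
    · rw [card_eq_zero]; ext y; simp [h]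
  · have hxv : x ≠ v := by rintro rfl; exact (G.irrefl ((hT x).2 hx))
    rw [← card_insert_of_notMem (s := G'.neighborFinset x) (a := v) (by simp [h])]
    congr 1; ext y
    have := (hT x).2 hx
    simp only [SimpleGraph.mem_neighborFinset, mem_insert, h]
    by_cases hy : y = v
    · subst hy; simp [this.symm]
    · simp [hy, hxv]
  · congr 1; ext y
    simp only [SimpleGraph.mem_neighborFinset, h]
    by_cases hy : y = v
    · subst hy
      simp only [ne_eq, not_true_eq_false, and_false, iff_false]
      exact fun hh => hx ((hT x).1 hh.symm)
    · simp [hy, hxv]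

/-- The list `L` contains the values of the function `δ`, which is zero elsewhere. -/
structure ListsDegrees {V : Type} (L : List (V × ℕ)) (δ : V → ℕ) : Prop where
  nodup : (L.map Prod.fst).Nodup
  mem : ∀ p ∈ L, δ p.1 = p.2
  zero : ∀ v, v ∉ L.map Prod.fst → δ v = 0

theorem ListsDegrees.perm {V : Type} {L L' : List (V × ℕ)} {δ : V → ℕ} (h : ListsDegrees L δ)
    (hp : L.Perm L') : ListsDegrees L' δ where
  nodup := (hp.map Prod.fst).nodup_iff.1 h.nodup
  mem := fun p hpm => h.mem p (hp.mem_iff.2 hpm)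
  zero := fun v hv => h.zero v (fun hh => hv ((hp.map Prod.fst).mem_iff.1 hh))

open Classical in
theorem ListsDegrees.reduce {V : Type} {v : V} {d : ℕ} {Q R : List (V × ℕ)} {δ : V → ℕ}
    (h : ListsDegrees ((v, d) :: (Q ++ R)) δ) :
    ListsDegrees (Q.map (fun a : V × ℕ => (a.1, a.2 - 1)) ++ R)
      (fun x => if x = v then 0 else if x ∈ (Q.map Prod.fst).toFinset then δ x - 1 else δ x) := by
  have hn := h.nodup
  simp only [List.map_cons, List.map_append, List.nodup_cons, List.mem_append] at hn
  have hn2 := List.nodup_append.1 hn.2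
  have hkeys : (Q.map (fun a : V × ℕ => (a.1, a.2 - 1)) ++ R).map Prod.fst
      = Q.map Prod.fst ++ R.map Prod.fst := by simp [Function.comp_def]
  refine ⟨by rw [hkeys]; exact hn.2, fun p hp => ?_, fun x hx => ?_⟩
  · rw [List.mem_append, List.mem_map] at hp
    rcases hp with ⟨a, ha, rfl⟩ | hp
    · have ha' : a.1 ∈ Q.map Prod.fst := List.mem_map_of_mem ha
      have hav : a.1 ≠ v := fun e => hn.1 (Or.inl (e ▸ ha'))
      simp only [hav, if_false, List.mem_toFinset, ha', if_true]
      rw [h.mem a (by simp [ha])]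
    · have ha' : p.1 ∈ R.map Prod.fst := List.mem_map_of_mem hp
      have hav : p.1 ≠ v := fun e => hn.1 (Or.inr (e ▸ ha'))
      have hpQ : p.1 ∉ Q.map Prod.fst := fun hq => hn2.2.2 _ hq _ ha' rfl
      simp only [hav, if_false, List.mem_toFinset, hpQ]
      exact h.mem p (by simp [hp])
  · rw [hkeys, List.mem_append] at hx
    push Not at hx
    simp only [List.mem_toFinset, hx.1, if_false]
    split_ifs with hxv
    · rfl
    · exact h.zero x (by simp only [List.map_cons, List.map_append, List.mem_cons,
        List.mem_append]; tauto)

-- Completeness of one step: sorting makes the next `d` vertices a set of largest degrees, so some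
-- realization joins `v` to exactly these, and isolating `v` there gives the reduced degrees.
open Classical in
theorem ListsDegrees.exists_reduced {V : Type} [Fintype V] {v : V} {d : ℕ} {rest : List (V × ℕ)}
    {δ : V → ℕ} (hL : ListsDegrees ((v, d) :: rest) δ)
    (hsort : rest.Pairwise (fun a b => b.2 ≤ a.2)) (G : SimpleGraph V)
    (hG : ∀ x, G.degree x = δ x) :
    ¬ (rest.length < d ∨ ∃ a ∈ rest.take d, a.2 = 0) ∧ ∃ G' : SimpleGraph V, ∀ x, G'.degree x =
      if x = v then 0 else
        if x ∈ ((rest.take d).map Prod.fst).toFinset then δ x - 1 else δ x := by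
  have hsplit := List.take_append_drop d rest
  have hδv : δ v = d := hL.mem (v, d) (by simp)
  have hnd := hL.nodup
  rw [List.map_cons, List.nodup_cons] at hnd
  have hδ : ∀ a ∈ rest, δ a.1 = a.2 := fun a ha => hL.mem a (List.mem_cons_of_mem _ ha)
  have hzero : ∀ y, y ≠ v → y ∉ rest.map Prod.fst → δ y = 0 := by
    intro y hy hyr
    refine hL.zero y ?_
    simp only [List.map_cons, List.mem_cons, not_or]
    exact ⟨hy, hyr⟩
  set Q := rest.take d with hQ
  set R := rest.drop d with hR
  set T : Finset V := (Q.map Prod.fst).toFinset with hTdef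
  have hmemT : ∀ x, x ∈ T ↔ ∃ e, (x, e) ∈ Q := by intro x; simp [hTdef]
  have hvT : v ∉ T := by
    intro h
    obtain ⟨e, he⟩ := (hmemT v).1 h
    exact hnd.1 (List.mem_map.2 ⟨_, List.mem_of_mem_take he, rfl⟩)
  have hQnd : (Q.map Prod.fst).Nodup := by
    rw [← hsplit, List.map_append] at hnd; exact hnd.2.of_append_left
  have hTcard : T.card = Q.length := by
    rw [hTdef, List.toFinset_card_of_nodup hQnd, List.length_map]
  have hδT : ∀ a ∈ Q, δ a.1 = a.2 := fun a ha => hδ a (List.mem_of_mem_take ha)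
  -- Neighbours of `v` have positive degree and are therefore listed.
  have hrest : d ≤ rest.length := by
    have hsub : G.neighborFinset v ⊆ (rest.map Prod.fst).toFinset := by
      intro y hy
      rw [SimpleGraph.mem_neighborFinset] at hy
      have hpos : δ y ≠ 0 := by
        rw [← hG y, ← SimpleGraph.card_neighborFinset_eq_degree]
        exact (card_pos.2 ⟨v, by simpa using hy.symm⟩).ne'
      by_contra hyr
      exact hpos (hzero y hy.ne' (by rwa [List.mem_toFinset] at hyr))
    have h1 := card_le_card hsub
    rw [SimpleGraph.card_neighborFinset_eq_degree, hG, hδv] at h1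
    refine h1.trans ((List.toFinset_card_le _).trans (by simp))
  have hTd : T.card = d := by rw [hTcard, hQ, List.length_take]; omega
  obtain ⟨G₁, hG₁, hN⟩ := exists_realization_neighborFinset_eq v T hvT _ G le_rfl
    (by rw [hTd, hG, hδv]) (by
      intro a ha b hb hbv
      rw [hG, hG]
      obtain ⟨e, he⟩ := (hmemT a).1 ha
      rw [hδT _ he]
      by_cases hbr : b ∈ R.map Prod.fst
      · obtain ⟨q, hq, rfl⟩ := List.mem_map.1 hbr
        rw [hδ q (List.mem_of_mem_drop hq)]
        rw [← hsplit, List.pairwise_append] at hsort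
        exact hsort.2.2 _ he _ hq
      · rw [hzero b hbv]
        · exact Nat.zero_le _
        · rw [← hsplit]
          simp only [List.map_append, List.mem_append]
          rw [hTdef, List.mem_toFinset] at hb
          tauto)
  have hdel := degree_eq_of_adj_iff_delete (G := G₁)
    (G' := SimpleGraph.fromRel fun x y => G₁.Adj x y ∧ x ≠ v ∧ y ≠ v) hN (by
      intro x y
      rw [SimpleGraph.fromRel_adj, G₁.adj_comm y x]
      constructor
      · tauto
      · exact fun h => ⟨h.1.ne, Or.inl h⟩)
  refine ⟨?_, SimpleGraph.fromRel fun x y => G₁.Adj x y ∧ x ≠ v ∧ y ≠ v, fun x => ?_⟩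
  · rintro (h | ⟨a, ha, h0⟩)
    · omega
    · have := (hdel a.1).2.1 ((hmemT _).2 ⟨a.2, ha⟩)
      rw [hG₁, hG, hδT a ha] at this
      omega
  · have := hdel x
    rw [hG₁, hG] at this
    split_ifs with h1 h2
    · exact (this.1 h1).2
    · rw [this.2.1 h2]; rfl
    · exact (this.2.2 h1 h2).symm

-- Soundness of one step: `v` has reduced degree `0`, so it is isolated in the graph of `E`, and
-- none of the new edges is already present.
open Classical in
theorem degree_fromRel_map_append {V : Type} [Fintype V] {v : V} {Q : List (V × ℕ)}
    {E : List (V × V)} {δ : V → ℕ} (hv : v ∉ Q.map Prod.fst) (hQ : (Q.map Prod.fst).Nodup)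
    (hδ : ∀ a ∈ Q, δ a.1 = a.2) (hpos : ∀ a ∈ Q, a.2 ≠ 0) (hδv : δ v = Q.length)
    (hE : ∀ x, (SimpleGraph.fromRel (fun a b => (a, b) ∈ E)).degree x =
      if x = v then 0 else if x ∈ (Q.map Prod.fst).toFinset then δ x - 1 else δ x) (x : V) :
    (SimpleGraph.fromRel (fun a b => (a, b) ∈ Q.map (fun a => (v, a.1)) ++ E)).degree x = δ x := by
  set T : Finset V := (Q.map Prod.fst).toFinset with hTdef
  have hmemT : ∀ x, x ∈ T ↔ ∃ e, (x, e) ∈ Q := by intro x; simp [hTdef]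
  have hvT : v ∉ T := by rwa [hTdef, List.mem_toFinset]
  have hTcard : T.card = Q.length := by
    rw [hTdef, List.toFinset_card_of_nodup hQ, List.length_map]
  set G' := SimpleGraph.fromRel (fun a b => (a, b) ∈ E) with hG'
  set G := SimpleGraph.fromRel
    (fun a b => (a, b) ∈ Q.map (fun a => (v, a.1)) ++ E) with hGdef
  have hiso : ∀ y, ¬ G'.Adj v y := by
    intro y hy
    have := hE v
    rw [if_pos rfl, SimpleGraph.degree, card_eq_zero] at this
    exact (eq_empty_iff_forall_notMem.1 this y) ((SimpleGraph.mem_neighborFinset _ _ _).2 hy)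
  have hadj : ∀ x y, G.Adj x y ↔ G'.Adj x y ∨ (x = v ∧ y ∈ T) ∨ (y = v ∧ x ∈ T) := by
    intro x y
    have hm : ∀ x y, (x, y) ∈ Q.map (fun a => (v, a.1)) ++ E ↔
        (x = v ∧ y ∈ T) ∨ (x, y) ∈ E := by
      intro x y
      rw [List.mem_append, List.mem_map, hmemT]
      constructor
      · rintro (⟨a, ha, he⟩ | h)
        · rw [Prod.mk.injEq] at he
          exact Or.inl ⟨he.1.symm, a.2, by rw [← he.2]; exact ha⟩
        · exact Or.inr h
      · rintro (⟨rfl, e, he⟩ | h)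
        · exact Or.inl ⟨_, he, rfl⟩
        · exact Or.inr h
    rw [hGdef, hG', SimpleGraph.fromRel_adj, SimpleGraph.fromRel_adj, hm, hm]
    constructor
    · tauto
    · rintro (h | ⟨rfl, h⟩ | ⟨rfl, h⟩)
      · tauto
      · exact ⟨fun e => hvT (e ▸ h), by tauto⟩
      · exact ⟨fun e => hvT (e ▸ h), by tauto⟩
  have hdel := degree_eq_of_adj_iff_delete (G := G) (G' := G') (v := v) (T := T)
    (fun x => by
      rw [hadj]
      constructor
      · rintro (h | h | h)
        · exact (hiso x h).elim
        · exact h.2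
        · exact (hvT h.2).elim
      · tauto)
    (fun x y => by
      rw [hadj]
      constructor
      · intro h
        exact ⟨Or.inl h, by rintro rfl; exact hiso _ h, by rintro rfl; exact hiso _ h.symm⟩
      · tauto)
  have hx := hdel x
  have hx' := hE x
  split_ifs at hx' with h1 h2
  · subst h1
    convert (hx.1 rfl).1.trans (hTcard.trans hδv.symm)
  · obtain ⟨e, he⟩ := (hmemT x).1 h2
    have h3 := hδ _ he
    have h4 := hpos _ he
    simp only at h3 h4
    have h5 : δ x - 1 + 1 = δ x := by omega
    convert (hx.2.1 h2).trans ((congrArg (· + 1) (by convert hx' : _ = δ x - 1)).trans h5)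
  · convert (hx.2.2 h1 h2).trans (by convert hx' : _ = δ x)

open Classical in
theorem havelHakimiEdges_spec {V : Type} [Fintype V] (k : ℕ) (L : List (V × ℕ)) (δ : V → ℕ)
    (hk : L.length ≤ k) (hL : ListsDegrees L δ) :
    (∀ E, havelHakimiEdges k L = some E →
      ∀ x, (SimpleGraph.fromRel (fun a b => (a, b) ∈ E)).degree x = δ x) ∧
    (havelHakimiEdges k L = none → ∀ G : SimpleGraph V, ¬ ∀ x, G.degree x = δ x) := by
  have empty_case : ∀ δ : V → ℕ, ListsDegrees [] δ →
      ∀ x, (SimpleGraph.fromRel (fun a b : V => (a, b) ∈ ([] : List (V × V)))).degree x = δ x := by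
    intro δ h x
    rw [h.zero x (by simp), ← SimpleGraph.card_neighborFinset_eq_degree, card_eq_zero]
    ext y; simp
  induction k generalizing L δ with
  | zero =>
    obtain rfl : L = [] := List.length_eq_zero_iff.1 (by omega)
    simpa [havelHakimiEdges] using empty_case δ hL
  | succ k ih =>
    have hperm := List.mergeSort_perm L (fun a b => decide (b.2 ≤ a.2))
    have hL' := hL.perm hperm.symm
    have hlen := hperm.length_eq
    have hsort : (L.mergeSort (fun a b => decide (b.2 ≤ a.2))).Pairwise (fun a b => b.2 ≤ a.2) := by
      have := List.pairwise_mergeSort (le := fun a b : V × ℕ => decide (b.2 ≤ a.2))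
        (by intro a b c; simp only [decide_eq_true_eq]; omega)
        (by intro a b; simp only [Bool.or_eq_true, decide_eq_true_eq]; omega) L
      simpa using this
    rw [havelHakimiEdges]
    generalize L.mergeSort (fun a b => decide (b.2 ≤ a.2)) = M at hperm hL' hlen hsort
    match M, hperm, hL', hlen, hsort with
    | [], _, hL', _, _ => simpa using empty_case δ hL'
    | (v, d) :: rest, _, hL', hlen, hsort =>
      have hsplit := List.take_append_drop d rest
      have hred := ListsDegrees.reduce (v := v) (d := d) (Q := rest.take d) (R := rest.drop d)
        (δ := δ) (by rw [hsplit]; exact hL')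
      have hnd := hL'.nodup
      rw [List.map_cons, List.nodup_cons] at hnd
      have hlen' : ((rest.take d).map (fun a : V × ℕ => (a.1, a.2 - 1)) ++ rest.drop d).length
          ≤ k := by
        have := congrArg List.length hsplit
        simp only [List.length_append, List.length_map, List.length_cons] at this hlen ⊢
        omega
      obtain ⟨ih1, ih2⟩ := ih _ _ hlen' hred
      have hreduced := hL'.exists_reduced (List.pairwise_cons.1 hsort).2
      simp only
      split_ifs with hbad
      · exact ⟨by simp, fun _ G hG => (hreduced G hG).1 hbad⟩
      · push Not at hbad
        constructor
        · intro E hE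
          rw [Option.map_eq_some_iff] at hE
          obtain ⟨E', hE', rfl⟩ := hE
          refine degree_fromRel_map_append (fun h => hnd.1 ?_) ?_
            (fun a ha => hL'.mem a (List.mem_cons_of_mem _ (List.mem_of_mem_take ha))) hbad.2 ?_
            (ih1 E' hE')
          · rw [← hsplit, List.map_append]; exact List.mem_append_left _ h
          · have := hnd.2
            rw [← hsplit, List.map_append] at this
            exact this.of_append_left
          · rw [hL'.mem (v, d) (by simp), List.length_take]
            omega
        · intro hnone G hG
          rw [Option.map_eq_none_iff] at hnone
          obtain ⟨_, G', hG'⟩ := hreduced G hG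
          exact ih2 hnone G' hG'

theorem havelHakimi_spec {V : Type} [Fintype V] [LinearOrder V] (d : V → ℕ) :
    (∀ G, havelHakimi d = some G → Realizes G d) ∧
      (havelHakimi d = none → ¬ ∃ G : SimpleGraph V, Realizes G d) := by
  have hspec := havelHakimiEdges_spec (Fintype.card V)
    (((Finset.univ : Finset V).sort (· ≤ ·)).map (fun v => (v, d v))) d
    (by simp) ⟨by simp [Function.comp_def], by simp, by simp⟩
  constructor
  · intro G hG
    rw [havelHakimi, Option.map_eq_some_iff] at hG
    obtain ⟨E, hE, rfl⟩ := hG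
    intro v
    convert hspec.1 E hE v
  · rintro hG ⟨G, h⟩
    rw [havelHakimi, Option.map_eq_none_iff] at hG
    exact hspec.2 hG G fun x => by convert h x

end HavelHakimi

/-! ### The agreement algorithm and its message encoding. -/

section Algorithm

open Finset

/-- The messages of the algorithm: an input degree, a node identifier or the empty item, and the
message that agreement has been reached. -/
inductive Msg (n k : ℕ) where
  | value (d : Fin (n ^ k + 1))
  | item (x : Option (Fin n))
  | done

instance (n k : ℕ) : Nonempty (Msg n k) := ⟨.done⟩

/-- A numbering of the messages. -/
def Msg.toNat {n k : ℕ} : Msg n k → ℕ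
  | .value d => d
  | .item none => n ^ k + 1
  | .item (some x) => n ^ k + 2 + x
  | .done => n ^ k + n + 2

theorem Msg.toNat_injective {n k : ℕ} : Function.Injective (Msg.toNat (n := n) (k := k)) := by
  rintro (⟨d, hd⟩ | (_ | ⟨x, hx⟩) | _) (⟨e, he⟩ | (_ | ⟨y, hy⟩) | _) h <;>
    simp only [Msg.toNat, Msg.value.injEq, Msg.item.injEq, Option.some.injEq, Fin.mk.injEq,
      reduceCtorEq] at h ⊢ <;> omega

theorem Msg.toNat_lt {n k : ℕ} (m : Msg n k) : m.toNat < n ^ k + n + 3 := by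
  rcases m with (⟨d, hd⟩ | (_ | ⟨x, hx⟩) | _) <;> simp only [Msg.toNat] <;> omega

theorem exists_injective_message (B : ℕ) :
    ∃ e : Fin (2 ^ B) → Message B, Function.Injective e := by
  have e : Fin (2 ^ B) ≃ (Fin B → Bool) := Fintype.equivOfCardEq (by simp)
  refine ⟨fun a => ⟨List.ofFn (e a), by simp⟩, fun a b h => ?_⟩
  exact e.injective (List.ofFn_injective (Subtype.ext_iff.1 h))

open Classical in
/-- The encoding of messages by bit strings. -/
noncomputable def Msg.encode {n k : ℕ} (B : ℕ) : Msg n k → Message B :=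
  if h : ∃ e : Msg n k → Message B, Function.Injective e then h.choose else fun _ => ⟨[], by simp⟩

/-- The decoding of messages. -/
noncomputable def Msg.decode {n k B : ℕ} : Message B → Msg n k :=
  Function.invFun (Msg.encode B)

theorem Msg.decode_encode {n k B : ℕ} (hB : n ^ k + n + 3 ≤ 2 ^ B) (m : Msg n k) :
    Msg.decode (Msg.encode B m) = m := by
  have h : ∃ e : Msg n k → Message B, Function.Injective e := by
    obtain ⟨e, he⟩ := exists_injective_message B
    exact ⟨fun m => e ⟨m.toNat, m.toNat_lt.trans_le hB⟩, fun a b hab =>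
      Msg.toNat_injective (Fin.mk.inj (he hab))⟩
  refine Function.leftInverse_invFun ?_ m
  rw [Msg.encode, dif_pos h]
  exact h.choose_spec

/-- The rounds of the algorithm: one `start` round, and then phases of four rounds. -/
inductive Stage where
  | start
  | contact
  | reply
  | announce
  | confirm

/-- The local state of a node. The node knows the degrees `vals`, proposes to exclude the nodes in
`excl`, and knows that those in `conf` are proposed by all running nodes. All nodes before `ptr`
have crashed. A node is informed if it knows that there is agreement on `excl`. The messages of
the next round are in `out`. -/
structure NodeState (n k : ℕ) where
  id : Fin n
  stage : Stage
  vals : Fin n → Option ℕ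
  excl : Finset (Fin n)
  conf : Finset (Fin n)
  ptr : ℕ
  informed : Prop
  out : Fin n → Option (Msg n k)

/-- The output for the degree sequence `D` without the entries at the nodes in `K`. -/
def outputOf {n : ℕ} (D : Fin n → ℕ) (K : Finset (Fin n)) : Output n :=
  ⟨Kᶜ, fun v => D v, havelHakimi fun v : (Kᶜ : Finset (Fin n)) => D v⟩

namespace NodeState

variable {n k : ℕ}

/-- The initial state of the node `v` with input degree `d`. -/
def initial (k : ℕ) (v : Fin n) (d : ℕ) : NodeState n k where
  id := v
  stage := .start
  vals := fun _ => none
  excl := ∅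
  conf := ∅
  ptr := 0
  informed := False
  -- The cap only keeps the set of messages finite; it has no effect on degrees of at most `n ^ k`.
  out := fun _ => some (.value ⟨min d (n ^ k), by omega⟩)

open Classical in
/-- A node that has been proposed but not confirmed. -/
noncomputable def objection (s : NodeState n k) : Option (Fin n) :=
  if h : ∃ x, x ∈ s.excl ∧ x ∉ s.conf then some h.choose else none

open Classical in
/-- Informed nodes inform all others, the leader contacts all others, and everyone else contacts
the supposed leader. -/
noncomputable def contactOut (s : NodeState n k) : Fin n → Option (Msg n k) := fun w =>
  if s.informed then some .done
  else if s.ptr = s.id ∨ w.val = s.ptr then some (.item none) else none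

/-- The degrees contained in the messages `h`. -/
def valuesOf (h : Fin n → Option (Msg n k)) (u : Fin n) : Option ℕ :=
  match h u with
  | some (.value d) => some d
  | _ => none

open Classical in
/-- The items contained in the messages `h`. -/
noncomputable def itemsOf (h : Fin n → Option (Msg n k)) : Finset (Fin n) :=
  univ.filter fun x => ∃ u, h u = some (.item (some x))

open Classical in
/-- An item contained in the messages `h`, if there is one. -/
noncomputable def pick (h : Fin n → Option (Msg n k)) : Msg n k :=
  if hx : (itemsOf h).Nonempty then .item (some hx.choose) else .done

/-- The change of state in the `start` round. -/
noncomputable def nextStart (s : NodeState n k) (h : Fin n → Option (Msg n k)) : NodeState n k :=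
  let t := { s with
    stage := .contact
    vals := valuesOf h
    excl := univ.filter fun u => valuesOf h u = none }
  { t with out := t.contactOut }

open Classical in
/-- The change of state in a `contact` round. -/
noncomputable def nextContact (s : NodeState n k) (h : Fin n → Option (Msg n k)) :
    NodeState n k :=
  { s with
    stage := .reply
    informed := ∃ u, h u = some .done
    out := fun w => if h w = some (.item none) then some (.item s.objection) else none }

open Classical in
/-- The change of state in a `reply` round. -/
noncomputable def nextReply (s : NodeState n k) (h : Fin n → Option (Msg n k)) : NodeState n k :=
  { s with
    stage := .announce
    ptr := if ¬ s.informed ∧ s.ptr ≠ s.id ∧ ∀ u : Fin n, u.val = s.ptr → h u = none then s.ptr + 1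
      else s.ptr
    out := fun _ => if ¬ s.informed ∧ s.ptr = s.id then some (pick h) else none }

open Classical in
/-- The change of state in an `announce` round. -/
noncomputable def nextAnnounce (s : NodeState n k) (h : Fin n → Option (Msg n k)) :
    NodeState n k :=
  { s with
    stage := .confirm
    excl := if s.informed then s.excl else s.excl ∪ itemsOf h
    informed := s.informed ∨ ∃ u, h u = some .done
    -- A leader hears itself: after announcing `.done` it falls silent, whereas after announcing an
    -- item it keeps the item and repeats it in the `confirm` round.
    out := fun w => if ∃ u, h u = some .done then none else s.out w }

/-- The change of state in a `confirm` round. -/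
noncomputable def nextConfirm (s : NodeState n k) (h : Fin n → Option (Msg n k)) :
    NodeState n k :=
  let t := { s with stage := .contact, conf := s.conf ∪ itemsOf h }
  { t with out := t.contactOut }

open Classical in
/-- The transition function of the algorithm. -/
noncomputable def next (s : NodeState n k) (h : Fin n → Option (Msg n k)) :
    NodeState n k ⊕ Output n :=
  match s.stage with
  | .start => .inl (s.nextStart h)
  | .contact =>
    if s.informed then .inr (outputOf (fun v => (s.vals v).getD 0) s.excl)
    else .inl (s.nextContact h)
  | .reply => .inl (s.nextReply h)
  | .announce => .inl (s.nextAnnounce h)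
  | .confirm => .inl (s.nextConfirm h)

end NodeState

/-- The algorithm. -/
noncomputable def algorithm (n k B : ℕ) : Protocol n B where
  State := NodeState n k
  init := NodeState.initial k
  send s w := (s.out w).map (Msg.encode B)
  -- The model delivers no message from a node to itself, so a node's own message is inserted here.
  receive s msgs := s.next fun u => if u = s.id then s.out u else (msgs u).map Msg.decode

/-! ### One round, abstracted from bit strings and crash sets. -/

variable {n k B : ℕ}

/-- The messages `h` are those that `v` gets in the round from `c` to `c'`, its own ones
included. -/
structure Hears (c c' : Config (algorithm n k B)) (v : Fin n) (h : Fin n → Option (Msg n k)) :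
    Prop where
  of_running : ∀ u (t : NodeState n k), c u = .running t → c' u ≠ .crashed → h u = t.out v
  exists_running : ∀ u m, h u = some m → ∃ t : NodeState n k, c u = .running t ∧ t.out v = some m

/-- There is a round that leads from `c` to `c'`. -/
structure Round (c c' : Config (algorithm n k B)) : Prop where
  halted : ∀ v o, c v = .halted o → c' v = .halted o
  crashed : ∀ v, c v = .crashed → c' v = .crashed
  running : ∀ v (s : NodeState n k), c v = .running s → c' v = .crashed ∨
    ∃ h, Hears c c' v h ∧ ((∃ s', s.next h = .inl s' ∧ c' v = .running s') ∨
      ∃ o, s.next h = .inr o ∧ c' v = .halted o)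

/-- Only messages between different nodes are decoded, so the bound on `B` matters only for `2 ≤ n`.
For `n = 1` the bandwidth of the main theorem is `0`. -/
theorem round_step (hB : 2 ≤ n → n ^ k + n + 3 ≤ 2 ^ B) (c : Config (algorithm n k B))
    (hid : ∀ v (s : NodeState n k), c v = .running s → s.id = v) (x : Crashes n) :
    Round c (c.step x) := by
  have hcr : ∀ u (t : NodeState n k), c u = .running t → c.step x u ≠ .crashed → x u = none := by
    intro u t hu hne
    by_contra hx
    obtain ⟨R, hR⟩ := Option.ne_none_iff_exists'.1 hx
    exact hne (by simp [Config.step, hu, hR])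
  refine ⟨fun v o hv => by simp [Config.step, hv], fun v hv => by simp [Config.step, hv],
    fun v s hv => ?_⟩
  rcases hxv : x v with _ | R
  swap
  · left; simp [Config.step, hv, hxv]
  right
  have hsv := hid v s hv
  have hdec : ∀ u (t : NodeState n k), u ≠ v → ∀ w,
      (((t.out w).map (Msg.encode B)).map Msg.decode : Option (Msg n k)) = t.out w := by
    intro u t huv w
    have hn : 2 ≤ n := by
      have := u.isLt; have := v.isLt
      by_contra hlt
      exact huv (Fin.ext (by omega))
    rw [Option.map_map]
    rw [show (Msg.decode ∘ Msg.encode B : Msg n k → Msg n k) = id from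
      funext (Msg.decode_encode (hB hn)), Option.map_id, id]
  refine ⟨fun u => if u = s.id then s.out u else (c.delivered x u v).map Msg.decode, ⟨?_, ?_⟩, ?_⟩
  · intro u t hu hne
    have hxu := hcr u t hu hne
    split_ifs with he
    · rw [hsv] at he; subst he
      rw [hv] at hu; cases hu; rfl
    · rw [hsv] at he
      simp only [Config.delivered, hxu, Config.sent, hu, if_neg he]
      exact hdec u t he v
  · intro u m hm
    split_ifs at hm with he
    · rw [hsv] at he; subst he
      exact ⟨s, hv, hm⟩
    · rw [hsv] at he
      have hsent : (c.sent u v).map Msg.decode = some m := by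
        simp only [Config.delivered] at hm
        rcases hxu : x u with _ | R
        · rw [hxu] at hm; exact hm
        · rw [hxu] at hm
          dsimp only at hm
          split_ifs at hm
          · exact hm
          · simp at hm
      simp only [Config.sent] at hsent
      rcases hu : c u with t | o | _
      · rw [hu] at hsent
        simp only [if_neg he] at hsent
        exact ⟨t, rfl, (hdec u t he v).symm.trans hsent⟩
      · rw [hu] at hsent; simp at hsent
      · rw [hu] at hsent; simp at hsent
  · generalize hy : s.next _ = y
    have hy' : (algorithm n k B).receive s (fun u => c.delivered x u v) = y := hy
    rcases y with s' | o
    · exact Or.inl ⟨s', rfl, by simp only [Config.step, hv, hxv, hy']⟩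
    · exact Or.inr ⟨o, rfl, by simp only [Config.step, hv, hxv, hy']⟩

theorem Round.of_running {c c' : Config (algorithm n k B)} (R : Round c c') {v : Fin n}
    {s' : NodeState n k} (hv : c' v = .running s') :
    ∃ (s : NodeState n k) (h : _), c v = .running s ∧ Hears c c' v h ∧ s.next h = .inl s' := by
  rcases hc : c v with s | o | _
  · rcases R.running v s hc with h | ⟨h, hh, ⟨t, ht, ht'⟩ | ⟨o, _, ho⟩⟩
    · rw [h] at hv; cases hv
    · rw [ht'] at hv; cases hv
      exact ⟨s, h, rfl, hh, ht⟩
    · rw [ho] at hv; cases hv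
  · rw [R.halted v o hc] at hv; cases hv
  · rw [R.crashed v hc] at hv; cases hv

theorem Round.of_halted {c c' : Config (algorithm n k B)} (R : Round c c') {v : Fin n}
    {o : Output n} (hv : c' v = .halted o) : c v = .halted o ∨
    ∃ (s : NodeState n k) (h : _), c v = .running s ∧ Hears c c' v h ∧ s.next h = .inr o := by
  rcases hc : c v with s | o' | _
  · rcases R.running v s hc with h | ⟨h, hh, ⟨t, _, ht'⟩ | ⟨o', ho, ho'⟩⟩
    · rw [h] at hv; cases hv
    · rw [ht'] at hv; cases hv
    · rw [ho'] at hv; cases hv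
      exact Or.inr ⟨s, h, rfl, hh, ho⟩
  · rw [R.halted v o' hc] at hv; exact Or.inl hv
  · rw [R.crashed v hc] at hv; cases hv

end Algorithm

/-! ### Invariants of the phases, and the `start` and `contact` rounds. -/

section Invariants

open Finset

namespace NodeState

variable {n k : ℕ} {s s' : NodeState n k} {h : Fin n → Option (Msg n k)} {o : Output n}

theorem objection_eq_some {x : Fin n} (hx : s.objection = some x) : x ∈ s.excl ∧ x ∉ s.conf := by
  rw [objection] at hx
  split_ifs at hx with hex
  cases hx
  exact hex.choose_spec

theorem objection_eq_none (hs : s.objection = none) : s.excl ⊆ s.conf := by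
  rw [objection] at hs
  split_ifs at hs with hex
  push Not at hex
  exact hex

theorem mem_itemsOf {x : Fin n} : x ∈ itemsOf h ↔ ∃ u, h u = some (.item (some x)) := by
  simp [itemsOf]

theorem valuesOf_eq_some {u : Fin n} {d : ℕ} (hd : valuesOf h u = some d) :
    ∃ e : Fin (n ^ k + 1), h u = some (.value e) ∧ e.val = d := by
  rw [valuesOf] at hd
  split at hd
  · rename_i e he
    exact ⟨e, he, Option.some.inj hd⟩
  · cases hd

theorem contactOut_eq_done {w : Fin n} (hw : s.contactOut w = some .done) : s.informed := by
  rw [contactOut] at hw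
  split_ifs at hw with h1
  · exact h1
  · cases hw

theorem contactOut_of_not_informed {w : Fin n} (hs : ¬ s.informed)
    (hw : s.contactOut w ≠ none) : s.ptr = s.id ∨ w.val = s.ptr := by
  rw [contactOut, if_neg hs] at hw
  by_contra h
  exact hw (if_neg h)

theorem pick_cases (h : Fin n → Option (Msg n k)) :
    (itemsOf h = ∅ ∧ pick h = .done) ∨ ∃ x ∈ itemsOf h, pick h = .item (some x) := by
  by_cases hx : (itemsOf h).Nonempty
  · exact Or.inr ⟨hx.choose, hx.choose_spec, by rw [pick, dif_pos hx]⟩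
  · exact Or.inl ⟨not_nonempty_iff_eq_empty.1 hx, by rw [pick, dif_neg hx]⟩

theorem next_of_start (hs : s.stage = .start) : s.next h = .inl (s.nextStart h) := by
  simp only [next, hs]

theorem next_contact_inl (hs : s.stage = .contact) (hn : s.next h = .inl s') :
    ¬ s.informed ∧ s' = s.nextContact h := by
  simp only [next, hs] at hn
  split_ifs at hn with hi
  cases hn
  exact ⟨hi, rfl⟩

theorem next_contact_inr (hs : s.stage = .contact) (hn : s.next h = .inr o) :
    s.informed ∧ o = outputOf (fun v => (s.vals v).getD 0) s.excl := by
  simp only [next, hs] at hn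
  split_ifs at hn with hi
  cases hn
  exact ⟨hi, rfl⟩

theorem next_of_reply (hs : s.stage = .reply) : s.next h = .inl (s.nextReply h) := by
  simp only [next, hs]

theorem next_of_announce (hs : s.stage = .announce) : s.next h = .inl (s.nextAnnounce h) := by
  simp only [next, hs]

theorem next_of_confirm (hs : s.stage = .confirm) : s.next h = .inl (s.nextConfirm h) := by
  simp only [next, hs]

theorem next_mono (hn : s.next h = .inl s') : s.ptr ≤ s'.ptr ∧ s.conf ⊆ s'.conf := by
  rcases hs : s.stage
  · rw [next_of_start hs] at hn
    cases hn
    exact ⟨le_rfl, subset_rfl⟩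
  · rw [(next_contact_inl hs hn).2]
    exact ⟨le_rfl, subset_rfl⟩
  · rw [next_of_reply hs] at hn
    cases hn
    refine ⟨?_, subset_rfl⟩
    simp only [nextReply]
    split_ifs <;> omega
  · rw [next_of_announce hs] at hn
    cases hn
    exact ⟨le_rfl, subset_rfl⟩
  · rw [next_of_confirm hs] at hn
    cases hn
    exact ⟨le_rfl, subset_union_left⟩

/-- Informed nodes ignore further items, which freezes their proposals. The `start` round is exempt
because it overwrites the proposal. -/
theorem next_informed (hs : s.stage ≠ .start) (hi : s.informed) (hn : s.next h = .inl s') :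
    s'.informed ∧ s'.excl = s.excl := by
  rcases hst : s.stage
  · exact (hs hst).elim
  · exact ((next_contact_inl hst hn).1 hi).elim
  · rw [next_of_reply hst] at hn
    cases hn
    exact ⟨hi, rfl⟩
  · rw [next_of_announce hst] at hn
    cases hn
    exact ⟨Or.inl hi, if_pos hi⟩
  · rw [next_of_confirm hst] at hn
    cases hn
    exact ⟨hi, rfl⟩

end NodeState

theorem outputOf_congr {n : ℕ} {D D' : Fin n → ℕ} {K : Finset (Fin n)}
    (h : ∀ v, v ∉ K → D v = D' v) : outputOf D K = outputOf D' K := by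
  have he : (fun v : (Kᶜ : Finset (Fin n)) => D v) = fun v : (Kᶜ : Finset (Fin n)) => D' v :=
    funext fun v => h v.1 (mem_compl.1 v.2)
  rw [outputOf, outputOf, he]

variable {n k B : ℕ} {c c' : Config (algorithm n k B)} {D : Fin n → ℕ} {q : Stage} {p : ℕ}

theorem Round.subset_crashedNodes (R : Round c c') : c.crashedNodes ⊆ c'.crashedNodes := by
  intro v hv
  simp only [Config.crashedNodes, mem_filter, mem_univ, true_and] at hv ⊢
  exact R.crashed v hv

theorem Round.card_crashedNodes_lt (R : Round c c') {v : Fin n} {s : NodeState n k}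
    (hv : c v = .running s) (hv' : c' v = .crashed) :
    c.crashedNodes.card < c'.crashedNodes.card := by
  refine card_lt_card ((ssubset_iff_of_subset R.subset_crashedNodes).2 ⟨v, ?_, ?_⟩)
  · simpa [Config.crashedNodes] using hv'
  · simp [Config.crashedNodes, hv]

/-- The running nodes are in the same stage, store correct degrees, and only propose crashed nodes,
among them all those whose degree they do not know. -/
def Synchronized (D : Fin n → ℕ) (q : Stage) (c : Config (algorithm n k B)) : Prop :=
  ∀ v (s : NodeState n k), c v = .running s → s.id = v ∧ s.stage = q ∧
    (∀ u d, s.vals u = some d → d = D u) ∧ (∀ u, s.vals u = none → u ∈ s.excl) ∧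
    ∀ u ∈ s.excl, c u = .crashed

/-- All running nodes know that there is agreement. -/
def Final (D : Fin n → ℕ) (c : Config (algorithm n k B)) : Prop :=
  ∃ K : Finset (Fin n), (∀ u ∈ K, c u = .crashed) ∧
    (∀ v (s : NodeState n k), c v = .running s → s.informed ∧ s.excl = K) ∧
    ∀ v o, c v = .halted o → o = outputOf D K

/-- No node has terminated, confirmed nodes are proposed by all, nodes before the pointers have
crashed, and if a node is informed, then there is agreement. -/
structure Good (c : Config (algorithm n k B)) : Prop where
  not_halted : ∀ v o, c v ≠ .halted o
  conf_subset : ∀ v (s : NodeState n k) w (t : NodeState n k), c v = .running s →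
    c w = .running t → s.conf ⊆ t.excl
  ptr : ∀ v (s : NodeState n k), c v = .running s → ∀ u : Fin n, u.val < s.ptr → c u = .crashed
  agree : ∀ v (s : NodeState n k), c v = .running s → s.informed →
    ∀ w (t : NodeState n k), c w = .running t → t.excl = t.conf

/-- Each proposal equals its owner's confirmed set, which is contained in every other proposal. -/
theorem Good.excl_eq (hG : Good c) {v w u : Fin n} {s t r : NodeState n k} (hv : c v = .running s)
    (hi : s.informed) (hw : c w = .running t) (hu : c u = .running r) : t.excl = r.excl := by
  refine subset_antisymm ?_ ?_
  · rw [hG.agree v s hv hi w t hw]; exact hG.conf_subset _ _ _ _ hw hu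
  · rw [hG.agree v s hv hi u r hu]; exact hG.conf_subset _ _ _ _ hu hw

/-- A running node is not among the crashed nodes before its own pointer. -/
theorem Good.ptr_le (hG : Good c) {v : Fin n} {s : NodeState n k} (hv : c v = .running s) :
    s.ptr ≤ v := by
  by_contra! h
  have := hG.ptr v s hv v h
  rw [hv] at this
  cases this

theorem Good.final (hG : Good c) (hS : Synchronized D q c)
    (hi : ∀ v (s : NodeState n k), c v = .running s → s.informed) : Final D c := by
  by_cases hex : ∃ v, ∃ s : NodeState n k, c v = .running s
  · obtain ⟨v, s, hv⟩ := hex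
    exact ⟨s.excl, (hS v s hv).2.2.2.2, fun w t hw => ⟨hi w t hw,
      hG.excl_eq hv (hi v s hv) hw hv⟩, fun w o ho => (hG.not_halted w o ho).elim⟩
  · push Not at hex
    exact ⟨∅, by simp, fun v s hv => (hex v s hv).elim, fun w o ho => (hG.not_halted w o ho).elim⟩

/-- The default `0` never reaches the output, since nodes of unknown degree are excluded. -/
theorem Synchronized.output_eq (hS : Synchronized D q c) {v : Fin n} {s : NodeState n k}
    (hv : c v = .running s) :
    outputOf (fun u => (s.vals u).getD 0) s.excl = outputOf D s.excl := by
  obtain ⟨_, _, h1, h2, _⟩ := hS v s hv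
  refine outputOf_congr fun u hu => ?_
  rcases hd : s.vals u with _ | d
  · exact (hu (h2 u hd)).elim
  · exact h1 u d hd

theorem Final.step (hF : Final D c) (hS : Synchronized D q c) (hq : q ≠ .start)
    (R : Round c c') : Final D c' := by
  obtain ⟨K, hK, hr, ho⟩ := hF
  refine ⟨K, fun u hu => R.crashed u (hK u hu), fun v s' hv' => ?_, fun v o hv' => ?_⟩
  · obtain ⟨s, h, hv, hh, hn⟩ := R.of_running hv'
    have h1 := NodeState.next_informed (by rw [(hS v s hv).2.1]; exact hq) (hr v s hv).1 hn
    exact ⟨h1.1, h1.2.trans (hr v s hv).2⟩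
  · rcases R.of_halted hv' with hv | ⟨s, h, hv, hh, hn⟩
    · exact ho v o hv
    · have hst := (hS v s hv).2.1
      rcases q
      · exact (hq rfl).elim
      · rw [(NodeState.next_contact_inr hst hn).2, hS.output_eq hv, (hr v s hv).2]
      · rw [NodeState.next_of_reply hst] at hn; cases hn
      · rw [NodeState.next_of_announce hst] at hn; cases hn
      · rw [NodeState.next_of_confirm hst] at hn; cases hn

/-- Lower bounds on the pointers and the confirmed nodes. -/
def LowerBounds (g : ℕ) (F : Finset (Fin n)) (c : Config (algorithm n k B)) : Prop :=
  ∀ v (s : NodeState n k), c v = .running s → g ≤ s.ptr ∧ F ⊆ s.conf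

/-- A measure for the progress of an execution. -/
def Progress (p : ℕ) (c : Config (algorithm n k B)) : Prop :=
  ∃ g F, LowerBounds g F c ∧ p ≤ c.crashedNodes.card + g + F.card

theorem LowerBounds.step {g : ℕ} {F : Finset (Fin n)} (hL : LowerBounds g F c)
    (R : Round c c') : LowerBounds g F c' := by
  intro v s' hv'
  obtain ⟨s, h, hv, hh, hn⟩ := R.of_running hv'
  have h1 := NodeState.next_mono hn
  have h2 := hL v s hv
  exact ⟨h2.1.trans h1.1, h2.2.trans h1.2⟩

theorem Progress.step (hP : Progress p c) (R : Round c c') : Progress p c' := by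
  obtain ⟨g, F, hL, hp⟩ := hP
  have := card_le_card R.subset_crashedNodes
  exact ⟨g, F, hL.step R, by omega⟩

theorem Progress.step_of_crash (hP : Progress p c) (R : Round c c') {v : Fin n}
    {s : NodeState n k} (hv : c v = .running s) (hv' : c' v = .crashed) :
    Progress (p + 1) c' := by
  obtain ⟨g, F, hL, hp⟩ := hP
  have := R.card_crashedNodes_lt hv hv'
  exact ⟨g, F, hL.step R, by omega⟩

/-- The invariant before the `contact` round of phase `p`. -/
structure ContactInv (D : Fin n → ℕ) (p : ℕ) (c : Config (algorithm n k B)) : Prop where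
  sync : Synchronized D .contact c
  out : ∀ v (s : NodeState n k), c v = .running s → s.out = s.contactOut
  mode : Final D c ∨ (Good c ∧ Progress p c)

/-- The invariant before the `reply` round of phase `p`. -/
structure ReplyInv (D : Fin n → ℕ) (p : ℕ) (c : Config (algorithm n k B)) : Prop where
  sync : Synchronized D .reply c
  out : ∀ w (t : NodeState n k), c w = .running t → ∀ v m, t.out v = some m →
    m = .item t.objection
  contacted : ∀ v (s : NodeState n k), c v = .running s → ¬ s.informed →
    ∀ w (t : NodeState n k), c w = .running t → (s.ptr = v ∨ w.val = s.ptr) →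
      t.out v = some (.item t.objection)
  few : ∃ (L : Finset (Fin n)) (f : Fin n → ℕ), L.card ≤ 1 ∧ ∀ w (t : NodeState n k),
    c w = .running t → ∀ v, t.out v ≠ none → v ∈ L ∨ w.val = f v
  mode : Final D c ∨ (Good c ∧ (Progress (p + 1) c ∨ (Progress p c ∧
    ∀ v (s : NodeState n k), c v = .running s → ¬ s.informed)))

/-- There is at most one node with messages to send. -/
def UniqueSender (c : Config (algorithm n k B)) : Prop :=
  ∀ v (s : NodeState n k) w (t : NodeState n k), c v = .running s → c w = .running t →
    ∀ x y, s.out x ≠ none → t.out y ≠ none → v = w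

/-- The invariant before the `announce` round of phase `p`. -/
structure AnnounceInv (D : Fin n → ℕ) (p : ℕ) (c : Config (algorithm n k B)) : Prop where
  sync : Synchronized D .announce c
  unique : UniqueSender c
  out : ∀ v (s : NodeState n k), c v = .running s → s.out = (fun _ => none) ∨
    (s.out = (fun _ => some .done) ∧
        ∀ w (t : NodeState n k), c w = .running t → t.excl = t.conf) ∨
      ∃ x, s.out = (fun _ => some (.item (some x))) ∧ c x = .crashed ∧
        ∀ w (t : NodeState n k), c w = .running t → ¬ t.informed
  mode : Final D c ∨ (Good c ∧ (Progress (p + 1) c ∨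
    ∃ g F, LowerBounds g F c ∧ p ≤ c.crashedNodes.card + g + F.card ∧
      ∃ v, ∃ s : NodeState n k, c v = .running s ∧ (s.out = (fun _ => some .done) ∨
        ∃ x ∉ F, s.out = (fun _ => some (.item (some x))))))

/-- The invariant before the `confirm` round of phase `p`. -/
structure ConfirmInv (D : Fin n → ℕ) (p : ℕ) (c : Config (algorithm n k B)) : Prop where
  sync : Synchronized D .confirm c
  unique : UniqueSender c
  out : ∀ v (s : NodeState n k), c v = .running s → s.out = (fun _ => none) ∨
    ∃ x, s.out = (fun _ => some (.item (some x))) ∧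
      ∀ w (t : NodeState n k), c w = .running t → x ∈ t.excl ∧ ¬ t.informed
  mode : Final D c ∨ (Good c ∧ (Progress (p + 1) c ∨
    ∃ g F, LowerBounds g F c ∧ p ≤ c.crashedNodes.card + g + F.card ∧
      ∃ v, ∃ s : NodeState n k, c v = .running s ∧
        ∃ x ∉ F, s.out = (fun _ => some (.item (some x)))))

theorem contactInv_of_start
    (hc : ∀ v, c v = .running (NodeState.initial k v (D v))) (hD : ∀ v, D v ≤ n ^ k)
    (R : Round c c') : ContactInv D 0 c' := by
  have hrun : ∀ v (s' : NodeState n k), c' v = .running s' →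
      ∃ h, Hears c c' v h ∧ s' = (NodeState.initial k v (D v)).nextStart h := by
    intro v s' hv'
    obtain ⟨s, h, hv, hh, hn⟩ := R.of_running hv'
    rw [hc v] at hv
    cases hv
    rw [NodeState.next_of_start rfl] at hn
    cases hn
    exact ⟨h, hh, rfl⟩
  refine ⟨fun v s' hv' => ?_, fun v s' hv' => ?_, Or.inr ⟨⟨fun v o ho => ?_, ?_, ?_, ?_⟩, 0, ∅,
    fun _ _ _ => ⟨Nat.zero_le _, empty_subset _⟩, Nat.zero_le _⟩⟩
  · obtain ⟨h, hh, rfl⟩ := hrun v s' hv'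
    refine ⟨rfl, rfl, fun u d hd => ?_, fun u hu => ?_, fun u hu => ?_⟩
    · obtain ⟨e, he, rfl⟩ := NodeState.valuesOf_eq_some hd
      obtain ⟨t, ht, htm⟩ := hh.exists_running u _ he
      rw [hc u] at ht
      cases ht
      simp only [NodeState.initial, Option.some.injEq, Msg.value.injEq] at htm
      rw [← htm]
      exact min_eq_left (hD u)
    · exact mem_filter.2 ⟨mem_univ _, hu⟩
    -- A node that does not crash in the first round delivers its degree to all.
    · by_contra hne
      have h1 := hh.of_running u _ (hc u) hne
      have h2 : NodeState.valuesOf h u = none := (mem_filter.1 hu).2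
      rw [NodeState.valuesOf, h1] at h2
      cases h2
  · obtain ⟨h, hh, rfl⟩ := hrun v s' hv'
    rfl
  · rcases R.of_halted ho with h | ⟨s, h, hv, hh, hn⟩
    · rw [hc v] at h; cases h
    · rw [hc v] at hv
      cases hv
      rw [NodeState.next_of_start rfl] at hn
      cases hn
  · intro v s w t hv _
    obtain ⟨h, hh, rfl⟩ := hrun v s hv
    exact empty_subset _
  · intro v s hv u hu
    obtain ⟨h, hh, rfl⟩ := hrun v s hv
    exact (Nat.not_lt_zero _ hu).elim
  · intro v s hv hi
    obtain ⟨h, hh, rfl⟩ := hrun v s hv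
    exact hi.elim

open Classical in
/-- The nodes that are leaders before a `contact` round. -/
noncomputable def leaders (c : Config (algorithm n k B)) : Finset (Fin n) :=
  univ.filter fun v => ∃ s : NodeState n k, c v = .running s ∧ ¬ s.informed ∧ s.ptr = v

theorem mem_leaders {v : Fin n} : v ∈ leaders c ↔
    ∃ s : NodeState n k, c v = .running s ∧ ¬ s.informed ∧ s.ptr = v := by
  simp [leaders]

/-- Of two leaders, the larger would have its pointer beyond the smaller one, which is still
running. -/
theorem Good.leader_unique (hG : Good c) {v w : Fin n} {s t : NodeState n k}
    (hv : c v = .running s) (hw : c w = .running t) (hs : s.ptr = v) (ht : t.ptr = w) : v = w := by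
  rcases lt_trichotomy v w with h | h | h
  · have := hG.ptr w t hw v (by rw [ht]; exact h)
    rw [hv] at this; cases this
  · exact h
  · have := hG.ptr v s hv w (by rw [hs]; exact h)
    rw [hw] at this; cases this

theorem ContactInv.card_leaders_le (hI : ContactInv D p c) : (leaders c).card ≤ 1 := by
  rw [card_le_one]
  intro v hv w hw
  obtain ⟨s, hs, hsi, hsp⟩ := mem_leaders.1 hv
  obtain ⟨t, ht, hti, htp⟩ := mem_leaders.1 hw
  rcases hI.mode with ⟨K, _, hK, _⟩ | ⟨hG, _⟩
  · exact (hsi (hK v s hs).1).elim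
  · exact hG.leader_unique hs ht hsp htp

/-- An informed node that survives this round has informed all others, which gives `Final`. If there
are informed nodes and all of them crash, this counts as progress. If there are none, nobody becomes
informed here. -/
theorem ContactInv.step (hI : ContactInv D p c) (R : Round c c') : ReplyInv D p c' := by
  have hrun : ∀ v (s' : NodeState n k), c' v = .running s' →
      ∃ (s : NodeState n k) (h : _), c v = .running s ∧ Hears c c' v h ∧ ¬ s.informed ∧
        s' = s.nextContact h := by
    intro v s' hv'
    obtain ⟨s, h, hv, hh, hn⟩ := R.of_running hv'
    exact ⟨s, h, hv, hh, NodeState.next_contact_inl (hI.sync v s hv).2.1 hn⟩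
  have hdone : ∀ v (s : NodeState n k) h u, c v = .running s → Hears c c' v h →
      h u = some .done → ∃ t : NodeState n k, c u = .running t ∧ t.informed := by
    intro v s h u hv hh hu
    obtain ⟨t, ht, htm⟩ := hh.exists_running u _ hu
    rw [hI.out u t ht] at htm
    exact ⟨t, ht, NodeState.contactOut_eq_done htm⟩
  have hsync : Synchronized D .reply c' := by
    intro v s' hv'
    obtain ⟨s, h, hv, hh, hi, rfl⟩ := hrun v s' hv'
    obtain ⟨h1, h2, h3, h4, h5⟩ := hI.sync v s hv
    exact ⟨h1, rfl, h3, h4, fun u hu => R.crashed u (h5 u hu)⟩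
  refine ⟨hsync, ?_, ?_, ?_, ?_⟩
  · intro w t' hw' v m hm
    obtain ⟨t, h, hw, hh, hi, rfl⟩ := hrun w t' hw'
    simp only [NodeState.nextContact] at hm
    split_ifs at hm
    cases hm
    rfl
  · intro v s' hv' hi' w t' hw' hsw
    obtain ⟨s, hs, hv, hhs, his, rfl⟩ := hrun v s' hv'
    obtain ⟨t, h, hw, hh, hi, rfl⟩ := hrun w t' hw'
    have h1 := hh.of_running v s hv (by rw [hv']; simp)
    rw [hI.out v s hv, NodeState.contactOut, if_neg his, if_pos] at h1
    · simp only [NodeState.nextContact, h1, if_true]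
      rfl
    · rw [(hI.sync v s hv).1]
      exact hsw
  -- Replies go only to nodes that made contact: to the unique leader, or from a supposed leader to
  -- a node pointing at it.
  · refine ⟨leaders c, fun v => match c v with | .running s => NodeState.ptr s | _ => 0,
      hI.card_leaders_le, fun w t' hw' v hv => ?_⟩
    obtain ⟨t, h, hw, hh, hi, rfl⟩ := hrun w t' hw'
    simp only [NodeState.nextContact, ne_eq, ite_eq_right_iff, reduceCtorEq, imp_false,
      not_not] at hv
    obtain ⟨s, hs, hsm⟩ := hh.exists_running v _ hv
    rw [hI.out v s hs] at hsm
    have hni : ¬ s.informed := by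
      intro hsi
      rw [NodeState.contactOut, if_pos hsi] at hsm
      cases hsm
    rcases NodeState.contactOut_of_not_informed hni (by rw [hsm]; simp) with h1 | h1
    · left
      rw [(hI.sync v s hs).1] at h1
      exact mem_leaders.2 ⟨s, hs, hni, h1⟩
    · right
      simp only [hs]
      exact h1
  · rcases hI.mode with hF | ⟨hG, hP⟩
    · exact Or.inl (hF.step hI.sync (by simp) R)
    by_cases hsurv : ∃ v, ∃ s : NodeState n k, c v = .running s ∧ s.informed ∧ c' v ≠ .crashed
    · left
      obtain ⟨v, s, hv, hi, hne⟩ := hsurv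
      refine ⟨s.excl, fun u hu => R.crashed u ((hI.sync v s hv).2.2.2.2 u hu),
        fun w t' hw' => ?_, fun w o hw' => ?_⟩
      · obtain ⟨t, h, hw, hh, hti, rfl⟩ := hrun w t' hw'
        have hK : t.excl = s.excl := hG.excl_eq hv hi hw hv
        refine ⟨⟨v, ?_⟩, hK⟩
        rw [hh.of_running v s hv hne, hI.out v s hv, NodeState.contactOut, if_pos hi]
      · rcases R.of_halted hw' with hw | ⟨t, h, hw, hh, hn⟩
        · exact (hG.not_halted w o hw).elim
        · rw [(NodeState.next_contact_inr (hI.sync w t hw).2.1 hn).2, hI.sync.output_eq hw,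
            hG.excl_eq hv hi hw hv]
    · push Not at hsurv
      right
      refine ⟨⟨fun v o hv' => ?_, ?_, ?_, ?_⟩, ?_⟩
      · rcases R.of_halted hv' with hv | ⟨t, h, hv, hh, hn⟩
        · exact hG.not_halted v o hv
        · have := hsurv v t hv (NodeState.next_contact_inr (hI.sync v t hv).2.1 hn).1
          rw [hv'] at this
          cases this
      · intro v s' w t' hv' hw'
        obtain ⟨s, _, hv, _, _, rfl⟩ := hrun v s' hv'
        obtain ⟨t, _, hw, _, _, rfl⟩ := hrun w t' hw'
        exact hG.conf_subset v s w t hv hw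
      · intro v s' hv' u hu
        obtain ⟨s, _, hv, _, _, rfl⟩ := hrun v s' hv'
        exact R.crashed u (hG.ptr v s hv u hu)
      · intro v s' hv' hi' w t' hw'
        obtain ⟨s, h, hv, hh, _, rfl⟩ := hrun v s' hv'
        obtain ⟨t, _, hw, _, _, rfl⟩ := hrun w t' hw'
        obtain ⟨u, hu⟩ := hi'
        obtain ⟨r, hr, hri⟩ := hdone v s h u hv hh hu
        exact hG.agree u r hr hri w t hw
      · by_cases hinf : ∃ v, ∃ s : NodeState n k, c v = .running s ∧ s.informed
        · obtain ⟨v, s, hv, hi⟩ := hinf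
          exact Or.inl (hP.step_of_crash R hv (hsurv v s hv hi))
        · refine Or.inr ⟨hP.step R, fun v s' hv' hi' => hinf ?_⟩
          obtain ⟨s, h, hv, hh, _, rfl⟩ := hrun v s' hv'
          obtain ⟨u, hu⟩ := hi'
          obtain ⟨r, hr, hri⟩ := hdone v s h u hv hh hu
          exact ⟨u, r, hr, hri⟩

end Invariants

/-! ### The `reply`, `announce` and `confirm` rounds. -/

section Steps

open Finset

variable {n k B : ℕ} {c c' : Config (algorithm n k B)} {D : Fin n → ℕ} {p : ℕ}

theorem ReplyInv.step (hI : ReplyInv D p c) (R : Round c c') : AnnounceInv D p c' := by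
  have hrun : ∀ v (s' : NodeState n k), c' v = .running s' →
      ∃ (s : NodeState n k) (h : _), c v = .running s ∧ Hears c c' v h ∧ s' = s.nextReply h := by
    intro v s' hv'
    obtain ⟨s, h, hv, hh, hn⟩ := R.of_running hv'
    rw [NodeState.next_of_reply (hI.sync v s hv).2.1] at hn
    exact ⟨s, h, hv, hh, (Sum.inl.inj hn).symm⟩
  have hsurv : ∀ v (s : NodeState n k), c v = .running s → c' v ≠ .crashed →
      ∃ h, Hears c c' v h ∧ c' v = .running (s.nextReply h) := by
    intro v s hv hne
    rcases R.running v s hv with h | ⟨h, hh, ⟨t, ht, ht'⟩ | ⟨o, ho, _⟩⟩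
    · exact (hne h).elim
    · rw [NodeState.next_of_reply (hI.sync v s hv).2.1] at ht
      cases ht
      exact ⟨h, hh, ht'⟩
    · rw [NodeState.next_of_reply (hI.sync v s hv).2.1] at ho
      cases ho
  have hitem : ∀ v h x, Hears c c' v h → x ∈ NodeState.itemsOf h → ∃ u, ∃ t : NodeState n k,
      c u = .running t ∧ x ∈ t.excl ∧ x ∉ t.conf := by
    intro v h x hh hx
    obtain ⟨u, hu⟩ := NodeState.mem_itemsOf.1 hx
    obtain ⟨t, ht, htm⟩ := hh.exists_running u _ hu
    have := hI.out u t ht v _ htm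
    rw [Msg.item.injEq] at this
    exact ⟨u, t, ht, NodeState.objection_eq_some this.symm⟩
  have hleader : ∀ v (s : NodeState n k) h x, c v = .running s →
      (s.nextReply h).out x ≠ none → ¬ s.informed ∧ s.ptr = v ∧ Good c := by
    intro v s h x hv hx
    simp only [NodeState.nextReply, ne_eq, ite_eq_right_iff, reduceCtorEq, imp_false,
      not_not] at hx
    rw [(hI.sync v s hv).1] at hx
    refine ⟨hx.1, hx.2, ?_⟩
    rcases hI.mode with ⟨K, _, hK, _⟩ | ⟨hG, _⟩
    · exact (hx.1 (hK v s hv).1).elim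
    · exact hG
  refine ⟨?_, ?_, ?_, ?_⟩
  · intro v s' hv'
    obtain ⟨s, h, hv, hh, rfl⟩ := hrun v s' hv'
    obtain ⟨h1, h2, h3, h4, h5⟩ := hI.sync v s hv
    exact ⟨h1, rfl, h3, h4, fun u hu => R.crashed u (h5 u hu)⟩
  · intro v s' w t' hv' hw' x y hx hy
    obtain ⟨s, h, hv, hh, rfl⟩ := hrun v s' hv'
    obtain ⟨t, h', hw, hh', rfl⟩ := hrun w t' hw'
    have h1 := hleader v s h x hv hx
    exact h1.2.2.leader_unique hv hw h1.2.1 (hleader w t h' y hw hy).2.1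
  · intro v s' hv'
    obtain ⟨s, h, hv, hh, rfl⟩ := hrun v s' hv'
    by_cases hout : ∃ x, (s.nextReply h).out x ≠ none
    · obtain ⟨x, hx⟩ := hout
      obtain ⟨hi, hp, hG⟩ := hleader v s h x hv hx
      right
      have ho : (s.nextReply h).out = fun _ => some (NodeState.pick h) := by
        funext y
        simp only [NodeState.nextReply]
        rw [if_pos ⟨hi, by rw [hp, (hI.sync v s hv).1]⟩]
      rcases NodeState.pick_cases h with ⟨h0, hd⟩ | ⟨y, hy, hd⟩
      -- Every node that is still running has replied to the leader without an objection, so its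
      -- proposal lies in its confirmed set.
      · left
        rw [hd] at ho
        refine ⟨ho, fun w t' hw' => ?_⟩
        obtain ⟨t, h', hw, hh', rfl⟩ := hrun w t' hw'
        have h1 := hh.of_running w t hw (by rw [hw']; simp)
        rw [hI.contacted v s hv hi w t hw (Or.inl hp)] at h1
        refine subset_antisymm (NodeState.objection_eq_none (s := t) ?_) (hG.conf_subset w t w t hw hw)
        rcases hob : t.objection with _ | z
        · rfl
        · rw [hob] at h1
          have : z ∈ NodeState.itemsOf h := NodeState.mem_itemsOf.2 ⟨w, h1⟩
          rw [h0] at this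
          simp at this
      -- An informed node would imply that all proposals are confirmed, against the objection `y`.
      · right
        rw [hd] at ho
        obtain ⟨u, t, ht, hye, hyc⟩ := hitem v h y hh hy
        refine ⟨y, ho, R.crashed y ((hI.sync u t ht).2.2.2.2 y hye), fun w r' hw' hri => hyc ?_⟩
        obtain ⟨r, h', hw, hh', rfl⟩ := hrun w r' hw'
        rw [← hG.agree w r hw hri u t ht]
        exact hye
    · push Not at hout
      exact Or.inl (funext hout)
  · rcases hI.mode with hF | ⟨hG, hP⟩
    · exact Or.inl (hF.step hI.sync (by simp) R)
    right
    refine ⟨⟨fun v o hv' => ?_, ?_, ?_, ?_⟩, ?_⟩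
    · rcases R.of_halted hv' with hv | ⟨t, h, hv, hh, hn⟩
      · exact hG.not_halted v o hv
      · rw [NodeState.next_of_reply (hI.sync v t hv).2.1] at hn
        cases hn
    · intro v s' w t' hv' hw'
      obtain ⟨s, _, hv, _, rfl⟩ := hrun v s' hv'
      obtain ⟨t, _, hw, _, rfl⟩ := hrun w t' hw'
      exact hG.conf_subset v s w t hv hw
    · intro v s' hv' u hu
      obtain ⟨s, h, hv, hh, rfl⟩ := hrun v s' hv'
      simp only [NodeState.nextReply] at hu
      split_ifs at hu with hcond
      -- The node just passed would have replied had it survived this round, so its silence proves a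
      -- crash.
      · rcases Nat.lt_succ_iff_lt_or_eq.1 hu with hlt | heq
        · exact R.crashed u (hG.ptr v s hv u hlt)
        · rcases hu' : c u with t | o | _
          · by_contra hne
            have h1 := hh.of_running u t hu' hne
            rw [hI.contacted v s hv hcond.1 u t hu' (Or.inr heq), hcond.2.2 u heq] at h1
            cases h1
          · exact (hG.not_halted u o hu').elim
          · exact R.crashed u hu'
      · exact R.crashed u (hG.ptr v s hv u hu)
    · intro v s' hv' hi' w t' hw'
      obtain ⟨s, h, hv, hh, rfl⟩ := hrun v s' hv'
      obtain ⟨t, _, hw, _, rfl⟩ := hrun w t' hw'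
      exact hG.agree v s hv hi' w t hw
    · rcases hP with hP | ⟨hP, hni⟩
      · exact Or.inl (hP.step R)
      by_cases hcr : ∃ v, ∃ s : NodeState n k, c v = .running s ∧ c' v = .crashed
      · obtain ⟨v, s, hv, hv'⟩ := hcr
        exact Or.inl (hP.step_of_crash R hv hv')
      push Not at hcr
      obtain ⟨g, F, hL, hp⟩ := hP
      have hcard := card_le_card R.subset_crashedNodes
      -- If node `g` runs, its pointer is squeezed to `g`, so it leads; an objection it picks is
      -- unconfirmed for its sender and hence outside `F`. Otherwise no reply comes from `g`, and
      -- every pointer at `g` moves on.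
      by_cases hg : ∃ v, ∃ s : NodeState n k, c v = .running s ∧ v.val = g
      · right
        obtain ⟨v, s, hv, rfl⟩ := hg
        have hptr : s.ptr = v := le_antisymm (hG.ptr_le hv) (hL v s hv).1
        obtain ⟨h, hh, hv'⟩ := hsurv v s hv (hcr v s hv)
        have ho : (s.nextReply h).out = fun _ => some (NodeState.pick h) := by
          funext y
          simp only [NodeState.nextReply]
          rw [if_pos ⟨hni v s hv, by rw [hptr, (hI.sync v s hv).1]⟩]
        refine ⟨v, F, hL.step R, by omega, v, _, hv', ?_⟩
        rcases NodeState.pick_cases h with ⟨h0, hd⟩ | ⟨y, hy, hd⟩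
        · left; rw [ho, hd]
        · right
          obtain ⟨u, t, ht, hye, hyc⟩ := hitem v h y hh hy
          exact ⟨y, fun hyF => hyc ((hL u t ht).2 hyF), by rw [ho, hd]⟩
      · left
        push Not at hg
        refine ⟨g + 1, F, fun v s' hv' => ?_, by omega⟩
        refine ⟨?_, (hL.step R v s' hv').2⟩
        obtain ⟨s, h, hv, hh, rfl⟩ := hrun v s' hv'
        have h1 := (hL v s hv).1
        have hptr := hG.ptr_le hv
        have hvg := hg v s hv
        simp only [NodeState.nextReply]
        split_ifs with hcond
        · omega
        · by_contra hlt
          have heq : s.ptr = g := by omega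
          refine hcond ⟨hni v s hv, ?_, fun u hu => ?_⟩
          · rw [(hI.sync v s hv).1]; omega
          · by_contra hne
            obtain ⟨m, hm⟩ := Option.ne_none_iff_exists'.1 hne
            obtain ⟨t, ht, _⟩ := hh.exists_running u m hm
            exact hg u t ht (hu.trans heq)

/-- A sender that survives this round has reached all running nodes: either all are now informed, or
all now propose its item. -/
theorem AnnounceInv.step (hI : AnnounceInv D p c) (R : Round c c') : ConfirmInv D p c' := by
  have hrun : ∀ v (s' : NodeState n k), c' v = .running s' →
      ∃ (s : NodeState n k) (h : _), c v = .running s ∧ Hears c c' v h ∧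
        s' = s.nextAnnounce h := by
    intro v s' hv'
    obtain ⟨s, h, hv, hh, hn⟩ := R.of_running hv'
    rw [NodeState.next_of_announce (hI.sync v s hv).2.1] at hn
    exact ⟨s, h, hv, hh, (Sum.inl.inj hn).symm⟩
  have hsurv : ∀ v (s : NodeState n k), c v = .running s → c' v ≠ .crashed →
      ∃ h, Hears c c' v h ∧ c' v = .running (s.nextAnnounce h) := by
    intro v s hv hne
    rcases R.running v s hv with h | ⟨h, hh, ⟨t, ht, ht'⟩ | ⟨o, ho, _⟩⟩
    · exact (hne h).elim
    · rw [NodeState.next_of_announce (hI.sync v s hv).2.1] at ht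
      cases ht
      exact ⟨h, hh, ht'⟩
    · rw [NodeState.next_of_announce (hI.sync v s hv).2.1] at ho
      cases ho
  have hitem : ∀ v h x, Hears c c' v h → x ∈ NodeState.itemsOf h → ∃ u, ∃ t : NodeState n k,
      c u = .running t ∧ t.out = (fun _ => some (.item (some x))) ∧ c x = .crashed ∧
        ∀ w (t : NodeState n k), c w = .running t → ¬ t.informed := by
    intro v h x hh hx
    obtain ⟨u, hu⟩ := NodeState.mem_itemsOf.1 hx
    obtain ⟨t, ht, htm⟩ := hh.exists_running u _ hu
    rcases hI.out u t ht with h1 | ⟨h1, _⟩ | ⟨y, h1, h2⟩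
    · rw [h1] at htm; cases htm
    · rw [h1] at htm; cases htm
    · have htm' := htm
      rw [h1] at htm'
      cases htm'
      exact ⟨u, t, ht, h1, h2⟩
  have hdone : ∀ v h u, Hears c c' v h → h u = some .done → ∃ t : NodeState n k,
      c u = .running t ∧ t.out = (fun _ => some .done) ∧
        ∀ w (t : NodeState n k), c w = .running t → t.excl = t.conf := by
    intro v h u hh hu
    obtain ⟨t, ht, htm⟩ := hh.exists_running u _ hu
    rcases hI.out u t ht with h1 | ⟨h1, h2⟩ | ⟨y, h1, h2⟩
    · rw [h1] at htm; cases htm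
    · exact ⟨t, ht, h1, h2⟩
    · rw [h1] at htm; cases htm
  -- As there is a single sender, agreement and an item are never announced in the same round.
  have hexcl : ∀ u (t : NodeState n k) x v (s : NodeState n k), c u = .running t →
      c v = .running s → t.out = (fun _ => some (.item (some x))) →
      s.out = (fun _ => some .done) → False := by
    intro u t x v s hu hv ht hs
    have := hI.unique u t v s hu hv u u (by rw [ht]; simp) (by rw [hs]; simp)
    subst this
    rw [hv] at hu
    cases hu
    have := congrFun (ht.symm.trans hs) u
    simp at this
  have hsub : ∀ (s : NodeState n k) h, s.excl ⊆ (s.nextAnnounce h).excl := by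
    intro s h
    simp only [NodeState.nextAnnounce]
    split_ifs
    · exact subset_rfl
    · exact subset_union_left
  have hsync : Synchronized D .confirm c' := by
    intro v s' hv'
    obtain ⟨s, h, hv, hh, rfl⟩ := hrun v s' hv'
    obtain ⟨h1, h2, h3, h4, h5⟩ := hI.sync v s hv
    refine ⟨h1, rfl, h3, fun u hu => hsub s h (h4 u hu), fun u hu => ?_⟩
    simp only [NodeState.nextAnnounce] at hu
    split_ifs at hu
    · exact R.crashed u (h5 u hu)
    · rcases mem_union.1 hu with hu | hu
      · exact R.crashed u (h5 u hu)
      · obtain ⟨_, _, _, _, h6, _⟩ := hitem v h u hh hu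
        exact R.crashed u h6
  have hkeep : ∀ u (t : NodeState n k) x, c u = .running t →
      t.out = (fun _ => some (.item (some x))) → ∀ w (s : NodeState n k) h, c w = .running s →
      Hears c c' w h → ¬ ∃ y, h y = some .done := by
    rintro u t x hu ht w s h hw hh ⟨y, hy⟩
    obtain ⟨r, hr, hr', _⟩ := hdone w h y hh hy
    exact hexcl u t x y r hu hr ht hr'
  refine ⟨hsync, ?_, ?_, ?_⟩
  · intro v s' w t' hv' hw' x y hx hy
    obtain ⟨s, h, hv, hh, rfl⟩ := hrun v s' hv'
    obtain ⟨t, h', hw, hh', rfl⟩ := hrun w t' hw'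
    refine hI.unique v s w t hv hw x y (fun h0 => hx ?_) (fun h0 => hy ?_)
    · simp only [NodeState.nextAnnounce, h0, ite_self]
    · simp only [NodeState.nextAnnounce, h0, ite_self]
  · intro v s' hv'
    obtain ⟨s, h, hv, hh, rfl⟩ := hrun v s' hv'
    rcases hI.out v s hv with h1 | ⟨h1, h2⟩ | ⟨x, h1, h2, h3⟩
    · left
      funext y
      simp only [NodeState.nextAnnounce, h1, ite_self]
    · left
      funext y
      have : h v = some .done := by
        rw [hh.of_running v s hv (by rw [hv']; simp), h1]
      simp only [NodeState.nextAnnounce]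
      exact if_pos ⟨v, this⟩
    · right
      refine ⟨x, ?_, fun w t' hw' => ?_⟩
      · funext y
        simp only [NodeState.nextAnnounce]
        rw [if_neg (hkeep v s x hv h1 v s h hv hh), h1]
      · obtain ⟨t, h', hw, hh', rfl⟩ := hrun w t' hw'
        have hx : x ∈ NodeState.itemsOf h' := NodeState.mem_itemsOf.2 ⟨v, by
          rw [hh'.of_running v s hv (by rw [hv']; simp), h1]⟩
        simp only [NodeState.nextAnnounce]
        rw [if_neg (h3 w t hw)]
        exact ⟨mem_union_right _ hx, not_or.2 ⟨h3 w t hw, hkeep v s x hv h1 w t h' hw hh'⟩⟩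
  · rcases hI.mode with hF | ⟨hG, hP⟩
    · exact Or.inl (hF.step hI.sync (by simp) R)
    have hG' : Good c' := by
      refine ⟨fun v o hv' => ?_, ?_, ?_, ?_⟩
      · rcases R.of_halted hv' with hv | ⟨t, h, hv, hh, hn⟩
        · exact hG.not_halted v o hv
        · rw [NodeState.next_of_announce (hI.sync v t hv).2.1] at hn
          cases hn
      · intro v s' w t' hv' hw'
        obtain ⟨s, _, hv, _, rfl⟩ := hrun v s' hv'
        obtain ⟨t, h, hw, _, rfl⟩ := hrun w t' hw'
        exact (hG.conf_subset v s w t hv hw).trans (hsub t h)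
      · intro v s' hv' u hu
        obtain ⟨s, h, hv, hh, rfl⟩ := hrun v s' hv'
        exact R.crashed u (hG.ptr v s hv u hu)
      · intro v s' hv' hi' w t' hw'
        obtain ⟨s, h, hv, hh, rfl⟩ := hrun v s' hv'
        obtain ⟨t, h', hw, hh', rfl⟩ := hrun w t' hw'
        -- No item arrives when some node is informed afterwards: a node informed before rules out
        -- senders of items, and a node informed now has heard `.done`.
        have key : t.excl = t.conf ∧ NodeState.itemsOf h' = ∅ := by
          rcases hi' with hi | ⟨u, hu⟩
          · refine ⟨hG.agree v s hv hi w t hw, eq_empty_iff_forall_notMem.2 fun x hx => ?_⟩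
            obtain ⟨_, _, _, _, _, h6⟩ := hitem w h' x hh' hx
            exact h6 v s hv hi
          · obtain ⟨r, hr, hr', hag⟩ := hdone v h u hh hu
            refine ⟨hag w t hw, eq_empty_iff_forall_notMem.2 fun x hx => ?_⟩
            obtain ⟨y, q, hy, hq, _, _⟩ := hitem w h' x hh' hx
            exact hexcl y q x u r hy hr hq hr'
        simp only [NodeState.nextAnnounce, key.2, union_empty, ite_self]
        exact key.1
    rcases hP with hP | hP
    · exact Or.inr ⟨hG', Or.inl (hP.step R)⟩
    obtain ⟨g, F, hL, hp, v, s, hv, hs⟩ := hP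
    by_cases hcr : c' v = .crashed
    · exact Or.inr ⟨hG', Or.inl (Progress.step_of_crash ⟨g, F, hL, hp⟩ R hv hcr)⟩
    have hcard := card_le_card R.subset_crashedNodes
    rcases hs with hs | ⟨x, hxF, hs⟩
    · left
      refine hG'.final hsync fun w t' hw' => ?_
      obtain ⟨t, h', hw, hh', rfl⟩ := hrun w t' hw'
      exact Or.inr ⟨v, by rw [hh'.of_running v s hv hcr, hs]⟩
    · right
      obtain ⟨h, hh, hv'⟩ := hsurv v s hv hcr
      refine ⟨hG', Or.inr ⟨g, F, hL.step R, by omega, v, _, hv', x, hxF, ?_⟩⟩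
      funext y
      simp only [NodeState.nextAnnounce]
      rw [if_neg (hkeep v s x hv hs v s h hv hh), hs]

/-- Whoever repeats an item survived announcing it, so all running nodes propose it already.
Confirming it is thus safe even if the sender crashes now and reaches only some nodes; if the sender
survives, the item joins `F`. -/
theorem ConfirmInv.step (hI : ConfirmInv D p c) (R : Round c c') : ContactInv D (p + 1) c' := by
  have hrun : ∀ v (s' : NodeState n k), c' v = .running s' →
      ∃ (s : NodeState n k) (h : _), c v = .running s ∧ Hears c c' v h ∧
        s' = s.nextConfirm h := by
    intro v s' hv'
    obtain ⟨s, h, hv, hh, hn⟩ := R.of_running hv'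
    rw [NodeState.next_of_confirm (hI.sync v s hv).2.1] at hn
    exact ⟨s, h, hv, hh, (Sum.inl.inj hn).symm⟩
  have hitem : ∀ v h x, Hears c c' v h → x ∈ NodeState.itemsOf h →
      ∀ w (t : NodeState n k), c w = .running t → x ∈ t.excl ∧ ¬ t.informed := by
    intro v h x hh hx
    obtain ⟨u, hu⟩ := NodeState.mem_itemsOf.1 hx
    obtain ⟨t, ht, htm⟩ := hh.exists_running u _ hu
    rcases hI.out u t ht with h1 | ⟨y, h1, h2⟩
    · rw [h1] at htm; cases htm
    · rw [h1] at htm; cases htm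
      exact h2
  refine ⟨?_, ?_, ?_⟩
  · intro v s' hv'
    obtain ⟨s, h, hv, hh, rfl⟩ := hrun v s' hv'
    obtain ⟨h1, h2, h3, h4, h5⟩ := hI.sync v s hv
    exact ⟨h1, rfl, h3, h4, fun u hu => R.crashed u (h5 u hu)⟩
  · intro v s' hv'
    obtain ⟨s, h, hv, hh, rfl⟩ := hrun v s' hv'
    rfl
  · rcases hI.mode with hF | ⟨hG, hP⟩
    · exact Or.inl (hF.step hI.sync (by simp) R)
    right
    refine ⟨⟨fun v o hv' => ?_, ?_, ?_, ?_⟩, ?_⟩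
    · rcases R.of_halted hv' with hv | ⟨t, h, hv, hh, hn⟩
      · exact hG.not_halted v o hv
      · rw [NodeState.next_of_confirm (hI.sync v t hv).2.1] at hn
        cases hn
    · intro v s' w t' hv' hw'
      obtain ⟨s, h, hv, hh, rfl⟩ := hrun v s' hv'
      obtain ⟨t, _, hw, _, rfl⟩ := hrun w t' hw'
      exact union_subset (hG.conf_subset v s w t hv hw) fun x hx => (hitem v h x hh hx w t hw).1
    · intro v s' hv' u hu
      obtain ⟨s, h, hv, hh, rfl⟩ := hrun v s' hv'
      exact R.crashed u (hG.ptr v s hv u hu)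
    · intro v s' hv' hi' w t' hw'
      obtain ⟨s, h, hv, hh, rfl⟩ := hrun v s' hv'
      obtain ⟨t, h', hw, hh', rfl⟩ := hrun w t' hw'
      have h0 : NodeState.itemsOf h' = ∅ :=
        eq_empty_iff_forall_notMem.2 fun x hx => (hitem w h' x hh' hx v s hv).2 hi'
      simp only [NodeState.nextConfirm, h0, union_empty]
      exact hG.agree v s hv hi' w t hw
    · rcases hP with hP | ⟨g, F, hL, hp, v, s, hv, x, hxF, hs⟩
      · exact hP.step R
      by_cases hcr : c' v = .crashed
      · exact Progress.step_of_crash ⟨g, F, hL, hp⟩ R hv hcr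
      have hcard := card_le_card R.subset_crashedNodes
      refine ⟨g, insert x F, fun w t' hw' => ?_, by rw [card_insert_of_notMem hxF]; omega⟩
      have hw2 := hL.step R w t' hw'
      obtain ⟨t, h', hw, hh', rfl⟩ := hrun w t' hw'
      refine ⟨hw2.1, insert_subset (mem_union_right _ (NodeState.mem_itemsOf.2 ⟨v, ?_⟩)) hw2.2⟩
      rw [hh'.of_running v s hv hcr, hs]

end Steps

/-! ### Counting messages and bounding the progress. -/

section Conclusion

open Finset

variable {n k B : ℕ} {c c' : Config (algorithm n k B)} {D : Fin n → ℕ} {q : Stage} {p : ℕ}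

open Classical in
/-- The nodes that are still running. -/
noncomputable def runningNodes (c : Config (algorithm n k B)) : Finset (Fin n) :=
  univ.filter fun v => ∃ s : NodeState n k, c v = .running s

theorem mem_runningNodes {v : Fin n} :
    v ∈ runningNodes c ↔ ∃ s : NodeState n k, c v = .running s := by
  simp [runningNodes]

/-- Each element of `X` accounts for at most `n` pairs as sender and `n` as receiver, and each of
the two functional relations for at most `n` pairs in all. -/
theorem card_filter_prod_le (X : Finset (Fin n)) (f : Fin n → ℕ) (P : Fin n × Fin n → Prop)
    [DecidablePred P]
    (h : ∀ v w, P (v, w) → v ∈ X ∨ w ∈ X ∨ w.val = f v ∨ v.val = f w) :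
    (univ.filter P).card ≤ n * (2 * X.card + 2) := by
  have h1 : (univ.filter fun q : Fin n × Fin n => q.2.val = f q.1).card ≤ n := by
    have := card_le_card_of_injOn (s := univ.filter fun q : Fin n × Fin n => q.2.val = f q.1)
      (t := (univ : Finset (Fin n))) Prod.fst (fun _ _ => mem_univ _) (by
        rintro ⟨a, b⟩ hab ⟨a', b'⟩ hab' rfl
        simp only [coe_filter, mem_univ, true_and, Set.mem_ofPred_eq] at hab hab'
        rw [Fin.ext (hab.trans hab'.symm)])
    simpa using this
  have h2 : (univ.filter fun q : Fin n × Fin n => q.1.val = f q.2).card ≤ n := by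
    have := card_le_card_of_injOn (s := univ.filter fun q : Fin n × Fin n => q.1.val = f q.2)
      (t := (univ : Finset (Fin n))) Prod.snd (fun _ _ => mem_univ _) (by
        rintro ⟨a, b⟩ hab ⟨a', b'⟩ hab' rfl
        simp only [coe_filter, mem_univ, true_and, Set.mem_ofPred_eq] at hab hab'
        rw [Fin.ext (hab.trans hab'.symm)])
    simpa using this
  have hsub : univ.filter P ⊆ ((X ×ˢ univ) ∪ (univ ×ˢ X)) ∪
      ((univ.filter fun q : Fin n × Fin n => q.2.val = f q.1) ∪
        (univ.filter fun q : Fin n × Fin n => q.1.val = f q.2)) := by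
    rintro ⟨v, w⟩ hq
    have := h v w (mem_filter.1 hq).2
    simp only [mem_union, mem_product, mem_univ, true_and, and_true, mem_filter]
    tauto
  have h3 := card_union_le (X ×ˢ (univ : Finset (Fin n))) (univ ×ˢ X)
  rw [card_product, card_product, card_univ, Fintype.card_fin] at h3
  calc _ ≤ _ := card_le_card hsub
    _ ≤ _ := card_union_le _ _
    _ ≤ (X.card * n + n * X.card) + (n + n) :=
      add_le_add h3 ((card_union_le _ _).trans (add_le_add h1 h2))
    _ = _ := by ring

theorem exists_of_sent {u w : Fin n} (h : (c.sent u w).isSome) :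
    ∃ s : NodeState n k, c u = .running s ∧ s.out w ≠ none := by
  rw [Config.sent] at h
  rcases hu : c u with s | o | _
  · rw [hu] at h
    dsimp only at h
    split_ifs at h
    · cases h
    · refine ⟨s, rfl, fun h0 => ?_⟩
      simp [algorithm, h0] at h
  · rw [hu] at h; cases h
  · rw [hu] at h; cases h

theorem numMessages_le (X : Finset (Fin n)) (f : Fin n → ℕ)
    (h : ∀ v (s : NodeState n k), c v = .running s → ∀ w, s.out w ≠ none →
      v ∈ X ∨ w ∈ X ∨ w.val = f v ∨ v.val = f w) :
    c.numMessages ≤ n * (2 * X.card + 2) := by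
  refine card_filter_prod_le X f _ fun v w hvw => ?_
  obtain ⟨s, hs, hsw⟩ := exists_of_sent hvw
  exact h v s hs w hsw

theorem Round.runningNodes_subset (R : Round c c') : runningNodes c' ⊆ runningNodes c := by
  intro v hv
  obtain ⟨s', hs'⟩ := mem_runningNodes.1 hv
  obtain ⟨s, _, hs, _⟩ := R.of_running hs'
  exact mem_runningNodes.2 ⟨s, hs⟩

/-- The summands with `runningNodes` are a reserve of `2n` messages per running node. It is not
needed here, but it is spent in `ContactInv.messages_le`. -/
theorem messages_le_of_card_le (R : Round c c') (X : Finset (Fin n)) (f : Fin n → ℕ)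
    (hX : X.card ≤ 1) (h : ∀ v (s : NodeState n k), c v = .running s → ∀ w, s.out w ≠ none →
      v ∈ X ∨ w ∈ X ∨ w.val = f v ∨ v.val = f w) :
    c.numMessages + 2 * n * (runningNodes c').card ≤ 4 * n + 2 * n * (runningNodes c).card := by
  have h1 := numMessages_le X f h
  have h2 := card_le_card R.runningNodes_subset
  nlinarith

/-- Arbitrarily many informed nodes may broadcast in this round, but each of them halts or crashes
in it, and its reserve of `2n` pays for its share. -/
theorem ContactInv.messages_le (hI : ContactInv D p c) (R : Round c c') :
    c.numMessages + 2 * n * (runningNodes c').card ≤ 4 * n + 2 * n * (runningNodes c).card := by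
  classical
  set J : Finset (Fin n) := univ.filter fun v => ∃ s : NodeState n k, c v = .running s ∧ s.informed
    with hJ
  have h1 := numMessages_le (c := c) (leaders c ∪ J)
    (fun v => match c v with | .running s => NodeState.ptr s | _ => 0) (by
      intro v s hv w hw
      rw [hI.out v s hv] at hw
      by_cases hi : s.informed
      · exact Or.inl (mem_union_right _ (mem_filter.2 ⟨mem_univ _, s, hv, hi⟩))
      · rcases NodeState.contactOut_of_not_informed hi hw with h | h
        · rw [(hI.sync v s hv).1] at h
          exact Or.inl (mem_union_left _ (mem_leaders.2 ⟨s, hv, hi, h⟩))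
        · right; right; left
          simp only [hv]
          exact h)
  have h2 : (leaders c ∪ J).card ≤ 1 + J.card :=
    (card_union_le _ _).trans (Nat.add_le_add_right hI.card_leaders_le _)
  have hdisj : Disjoint J (runningNodes c') := by
    rw [disjoint_left]
    intro v hv hv'
    obtain ⟨s, hs, hi⟩ := (mem_filter.1 hv).2
    obtain ⟨s', hs'⟩ := mem_runningNodes.1 hv'
    obtain ⟨t, h, ht, _, hn⟩ := R.of_running hs'
    rw [hs] at ht
    cases ht
    exact (NodeState.next_contact_inl (hI.sync v s hs).2.1 hn).1 hi
  have h3 : J.card + (runningNodes c').card ≤ (runningNodes c).card := by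
    rw [← card_union_of_disjoint hdisj]
    refine card_le_card (union_subset (fun v hv => ?_) R.runningNodes_subset)
    obtain ⟨s, hs, _⟩ := (mem_filter.1 hv).2
    exact mem_runningNodes.2 ⟨s, hs⟩
  nlinarith

theorem ReplyInv.messages_le (hI : ReplyInv D p c) (R : Round c c') :
    c.numMessages + 2 * n * (runningNodes c').card ≤ 4 * n + 2 * n * (runningNodes c).card := by
  obtain ⟨L, f, hL, h⟩ := hI.few
  refine messages_le_of_card_le R L f hL fun v s hv w hw => ?_
  rcases h v s hv w hw with h | h
  · exact Or.inr (Or.inl h)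
  · exact Or.inr (Or.inr (Or.inr h))

theorem UniqueSender.messages_le (hU : UniqueSender c) (R : Round c c') :
    c.numMessages + 2 * n * (runningNodes c').card ≤ 4 * n + 2 * n * (runningNodes c).card := by
  classical
  refine messages_le_of_card_le R
    (univ.filter fun v => ∃ s : NodeState n k, c v = .running s ∧ ∃ w, s.out w ≠ none)
    (fun _ => 0) (card_le_one.2 fun v hv w hw => ?_) fun v s hv w hw => ?_
  · obtain ⟨s, hs, x, hx⟩ := (mem_filter.1 hv).2
    obtain ⟨t, ht, y, hy⟩ := (mem_filter.1 hw).2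
    exact hU v s w t hs ht x y hx hy
  · exact Or.inl (mem_filter.2 ⟨mem_univ _, s, hv, w, hw⟩)

/-- As `f < n`, some node is still running. Its confirmed set contains `F` and consists of crashed
nodes, and its pointer is at least `g` and has only crashed nodes before it, so all three terms are
at most `f`. -/
theorem Good.progress_le (hG : Good c) (hS : Synchronized D q c) {f : ℕ} (hf : f < n)
    (hcr : c.crashedNodes.card ≤ f) (hP : Progress p c) : p ≤ 3 * f := by
  have hmem : ∀ u, c u = .crashed → u ∈ c.crashedNodes := by
    intro u hu
    simpa [Config.crashedNodes] using hu
  obtain ⟨v, hv⟩ : ∃ v, v ∉ c.crashedNodes := by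
    by_contra! h
    rw [eq_univ_of_forall h, card_univ, Fintype.card_fin] at hcr
    omega
  obtain ⟨g, F, hL, hp⟩ := hP
  rcases hs : c v with s | o | _
  · have h1 : F.card ≤ c.crashedNodes.card := card_le_card fun u hu =>
      hmem u ((hS v s hs).2.2.2.2 u (hG.conf_subset v s v s hs hs ((hL v s hs).2 hu)))
    have h2 : (range s.ptr).card ≤ c.crashedNodes.card := by
      have hlt := hG.ptr_le hs
      refine card_le_card_of_surjOn Fin.val fun i hi => ?_
      have hi' : i < s.ptr := by simpa using hi
      have hin : i < n := by have := v.isLt; omega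
      exact ⟨⟨i, hin⟩, hmem _ (hG.ptr v s hs ⟨i, hin⟩ hi'), rfl⟩
    have h3 := (hL v s hs).1
    rw [card_range] at h2
    omega
  · exact (hG.not_halted v o hs).elim
  · exact (hv (hmem v hs)).elim

theorem Final.solvesRealization (hF : Final D c) (hr : ∀ v (s : NodeState n k), c v ≠ .running s)
    {f : ℕ} (hcr : c.crashedNodes.card ≤ f) : SolvesRealization D f c := by
  obtain ⟨K, hK, _, ho⟩ := hF
  have hsub : K ⊆ c.crashedNodes := by
    intro u hu
    simpa [Config.crashedNodes] using hK u hu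
  have hspec := havelHakimi_spec fun v : (Kᶜ : Finset (Fin n)) => D v
  refine ⟨Kᶜ, fun v => D v, havelHakimi fun v : (Kᶜ : Finset (Fin n)) => D v, fun _ => rfl, ?_,
    fun v hv => hsub (by simpa using hv), fun v hv => ?_, rfl, hspec.1, hspec.2⟩
  · have := card_le_card hsub
    rw [card_compl, Fintype.card_fin]
    omega
  · rcases hs : c v with s | o | _
    · exact (hr v s hs).elim
    · rw [ho v o hs]; rfl
    · exact (hv (by simpa [Config.crashedNodes] using hs)).elim

theorem Final.not_running_step (hF : Final D c) (hS : Synchronized D .contact c)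
    (R : Round c c') (v : Fin n) (s' : NodeState n k) : c' v ≠ .running s' := by
  obtain ⟨K, _, hr, _⟩ := hF
  intro hv'
  obtain ⟨s, h, hv, _, hn⟩ := R.of_running hv'
  exact (NodeState.next_contact_inl (hS v s hv).2.1 hn).1 (hr v s hv).1

/-! ### Whole executions: termination and the total number of messages. -/

section Execution

variable (hB : 2 ≤ n → n ^ k + n + 3 ≤ 2 ^ B) (hD : ∀ v, D v ≤ n ^ k)
  (adv : Adversary (algorithm n k B))

include hB in
theorem Synchronized.round_config {q : Stage} {r : ℕ}
    (hS : Synchronized D q ((algorithm n k B).config D adv r)) :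
    Round ((algorithm n k B).config D adv r) ((algorithm n k B).config D adv (r + 1)) :=
  round_step hB _ (fun v s hv => (hS v s hv).1) _

include hB hD in
theorem contactInv_config_one : ContactInv D 0 ((algorithm n k B).config D adv 1) := by
  refine contactInv_of_start (c := (algorithm n k B).config D adv 0) (fun v => rfl) hD ?_
  refine round_step hB _ (fun v s hv => ?_) _
  cases hv
  rfl

include hB hD in
theorem contactInv_config (p : ℕ) :
    ContactInv D p ((algorithm n k B).config D adv (4 * p + 1)) := by
  induction p with
  | zero => exact contactInv_config_one hB hD adv
  | succ p ih =>
    have h1 := ih.step (ih.sync.round_config hB adv)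
    have h2 := h1.step (h1.sync.round_config hB adv)
    have h3 := h2.step (h2.sync.round_config hB adv)
    exact h3.step (h3.sync.round_config hB adv)

include hB hD in
theorem round_config_and_messages_le (r : ℕ) :
    Round ((algorithm n k B).config D adv (r + 1)) ((algorithm n k B).config D adv (r + 2)) ∧
    ((algorithm n k B).config D adv (r + 1)).numMessages +
        2 * n * (runningNodes ((algorithm n k B).config D adv (r + 2))).card ≤
      4 * n + 2 * n * (runningNodes ((algorithm n k B).config D adv (r + 1))).card := by
  have h0 := contactInv_config hB hD adv (r / 4)
  have R0 := h0.sync.round_config hB adv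
  have h1 := h0.step R0
  have R1 := h1.sync.round_config hB adv
  have h2 := h1.step R1
  have R2 := h2.sync.round_config hB adv
  have h3 := h2.step R2
  have R3 := h3.sync.round_config hB adv
  have hr := Nat.div_add_mod r 4
  have hlt := Nat.mod_lt r (show 0 < 4 by norm_num)
  have : r = 4 * (r / 4) ∨ r = 4 * (r / 4) + 1 ∨ r = 4 * (r / 4) + 2 ∨ r = 4 * (r / 4) + 3 := by
    omega
  generalize r / 4 = m at *
  rcases this with rfl | rfl | rfl | rfl
  · exact ⟨R0, h0.messages_le R0⟩
  · exact ⟨R1, h1.messages_le R1⟩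
  · exact ⟨R2, h2.unique.messages_le R2⟩
  · exact ⟨R3, h3.unique.messages_le R3⟩

include hB hD in
theorem final_config {f : ℕ} (hf : f < n)
    (hcr : ∀ r, ((algorithm n k B).config D adv r).crashedNodes.card ≤ f) (r : ℕ) :
    Final D ((algorithm n k B).config D adv (12 * f + 6 + r)) ∧
      ∀ v (s : NodeState n k), (algorithm n k B).config D adv (12 * f + 6 + r) v ≠ .running s := by
  induction r with
  | zero =>
    -- After the `start` round and `3f + 1` phases the progress would exceed `3f`, so `Final` holds.
    -- One more `contact` round makes all informed nodes halt: `1 + 4(3f + 1) + 1 = 12f + 6`.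
    have hI := contactInv_config hB hD adv (3 * f + 1)
    have hR := hI.sync.round_config hB adv
    have hF : Final D ((algorithm n k B).config D adv (4 * (3 * f + 1) + 1)) := by
      rcases hI.mode with hF | ⟨hG, hP⟩
      · exact hF
      · have := hG.progress_le hI.sync hf (hcr _) hP
        omega
    rw [show 12 * f + 6 + 0 = 4 * (3 * f + 1) + 1 + 1 by ring]
    exact ⟨hF.step hI.sync (by simp) hR, hF.not_running_step hI.sync hR⟩
  | succ r ih =>
    have hR := (round_config_and_messages_le hB hD adv (12 * f + 5 + r)).1
    rw [show 12 * f + 5 + r + 1 = 12 * f + 6 + r by ring,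
      show 12 * f + 5 + r + 2 = 12 * f + 6 + (r + 1) by ring] at hR
    -- No node is running, so any stage other than `start` would do.
    refine ⟨ih.1.step (q := .contact) (fun v s hv => (ih.2 v s hv).elim) (by simp) hR,
      fun v s' hv' => ?_⟩
    obtain ⟨s, _, hv, _⟩ := hR.of_running hv'
    exact ih.2 v s hv

include hB hD in
theorem sum_numMessages_le {f : ℕ} (hf : f < n)
    (hcr : ∀ r, ((algorithm n k B).config D adv r).crashedNodes.card ≤ f) (T : ℕ) :
    ∑ r ∈ range T, ((algorithm n k B).config D adv r).numMessages ≤ 51 * n ^ 2 := by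
  set m : ℕ → ℕ := fun r => ((algorithm n k B).config D adv r).numMessages with hm
  have h0 : m 0 ≤ n * n := by
    refine (card_le_univ _).trans ?_
    simp
  -- The first round costs at most `n²`, the initial reserve is at most `2n²`, and each later round
  -- adds at most `4n`.
  have hpartial : ∀ T, ∑ r ∈ range (T + 1), m r +
      2 * n * (runningNodes ((algorithm n k B).config D adv (T + 1))).card ≤
        3 * (n * n) + 4 * n * T := by
    intro T
    induction T with
    | zero =>
      have h1 : (runningNodes ((algorithm n k B).config D adv (0 + 1))).card ≤ n := by
        simpa using card_le_univ (runningNodes ((algorithm n k B).config D adv (0 + 1)))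
      rw [sum_range_one]
      nlinarith
    | succ T ih =>
      have h1 : m (T + 1) + _ ≤ _ := (round_config_and_messages_le hB hD adv T).2
      rw [sum_range_succ]
      linarith
  have hzero : ∀ r, m (12 * f + 6 + r) = 0 := by
    intro r
    refine card_eq_zero.2 (eq_empty_iff_forall_notMem.2 fun q hq => ?_)
    obtain ⟨s, hs, _⟩ := exists_of_sent (mem_filter.1 hq).2
    exact (final_config hB hD adv hf hcr r).2 _ s hs
  have hle : ∑ r ∈ range T, m r ≤ ∑ r ∈ range (12 * f + 6), m r := by
    rcases le_total T (12 * f + 6) with h | h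
    · exact sum_le_sum_of_subset (range_subset_range.2 h)
    · obtain ⟨j, rfl⟩ := Nat.exists_eq_add_of_le h
      rw [sum_range_add, sum_eq_zero (s := range j) fun r _ => hzero r, add_zero]
  have h1 := hpartial (12 * f + 5)
  rw [show 12 * f + 5 + 1 = 12 * f + 6 by ring] at h1
  have h2 : 12 * f + 5 ≤ 12 * n := by omega
  have h3 : 4 * n * (12 * f + 5) ≤ 4 * n * (12 * n) := Nat.mul_le_mul_left _ h2
  have h4 : ∑ r ∈ range (12 * f + 6), m r ≤ 3 * (n * n) + 4 * n * (12 * n) := by omega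
  calc _ ≤ _ := hle.trans h4
    _ = _ := by ring

end Execution

/-- Since `log n ≥ 1`, the number `n` is below `2 ^ (2 log n)`; and `n ^ k + n + 3 ≤ n ^ k (n + 4) ≤
n ^ (k + 3)`. -/
theorem pow_add_add_le_two_pow_log (n k C : ℕ) (hn : 2 ≤ n) (hC : 2 * (k + 3) ≤ C) :
    n ^ k + n + 3 ≤ 2 ^ (C * Nat.log 2 n) := by
  have h1 : n < 2 ^ (2 * Nat.log 2 n) := by
    refine (Nat.lt_pow_succ_log_self (by norm_num) n).trans_le (Nat.pow_le_pow_right (by norm_num) ?_)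
    have := Nat.log_pos (b := 2) (by norm_num) hn
    omega
  have h2 : n ^ (k + 3) ≤ 2 ^ (C * Nat.log 2 n) := by
    calc n ^ (k + 3) ≤ (2 ^ (2 * Nat.log 2 n)) ^ (k + 3) := Nat.pow_le_pow_left h1.le _
      _ = 2 ^ (2 * (k + 3) * Nat.log 2 n) := by rw [← pow_mul]; ring_nf
      _ ≤ _ := Nat.pow_le_pow_right (by norm_num) (Nat.mul_le_mul_right _ hC)
  refine le_trans ?_ h2
  have h3 : 1 ≤ n ^ k := Nat.one_le_pow _ _ (by omega)
  have h4 : n + 4 ≤ n ^ 3 := by nlinarith [Nat.mul_le_mul hn hn, Nat.mul_le_mul_right n hn]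
  rw [pow_add]
  nlinarith

end Conclusion

theorem mainTheorem1 (k : ℕ) :
    ∃ (C : ℕ) (A : (n : ℕ) → Protocol n (C * Nat.log 2 n)),
      ∀ n f : ℕ, f < n →
      ∀ D : Fin n → ℕ, (∀ v, D v ≤ n ^ k) →
      ∀ adv : Adversary (A n),
        (∀ r, ((A n).config D adv r).crashedNodes.card ≤ f) →
        SolvesRealization D f ((A n).config D adv (C * (f + 1))) ∧
        ∀ T, ∑ r ∈ Finset.range T, ((A n).config D adv r).numMessages ≤ C * n ^ 2 := by
  -- One constant covers the message count `51n²`, the `12f + 6` rounds, and the factor `2(k + 3)`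
  -- in the message length.
  refine ⟨2 * k + 51, fun n => algorithm n k _, fun n f hf D hD adv hcr => ?_⟩
  have hB : 2 ≤ n → n ^ k + n + 3 ≤ 2 ^ ((2 * k + 51) * Nat.log 2 n) := fun hn =>
    pow_add_add_le_two_pow_log n k _ hn (by omega)
  constructor
  · obtain ⟨j, hj⟩ : ∃ j, (2 * k + 51) * (f + 1) = 12 * f + 6 + j :=
      Nat.exists_eq_add_of_le (by nlinarith)
    rw [hj]
    obtain ⟨hF, hr⟩ := final_config hB hD adv hf hcr j
    exact hF.solvesRealization hr (hcr _)
  · intro T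
    exact (sum_numMessages_le hB hD adv hf hcr T).trans (Nat.mul_le_mul_right _ (by omega))
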